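/- Let $(W,S)$ be a finite Coxeter system with length function $\ell$. Put $D(w)=\{s\in S:\ell(ws)<\ell(w)\}$ for $w\in W$, and $D_I(W)=\{w\in W:D(w)=I\}$ for $I\subseteq S$; a subset of $W$ is identified with the sum of its elements in $\mathbb{Z}W$. Let $\Sigma(W)\subseteq\mathbb{Z}W$ be the $\mathbb{Z}$-span of all $D_I(W)$, $I\subseteq S$, let $\Sigma^*(W)$ be its dual $\mathbb{Z}$-module, and let $\chi:\mathbb{Z}W\to\Sigma^*(W)$ be dual to the inclusion $\imath:\Sigma(W)\hookrightarrow\mathbb{Z}W$ with respect to the form $\langle u,v\rangle=\delta_{u,v}$ $(u,v\in W)$ on $\mathbb{Z}W$. Put $\chi'(w)=\chi(w^{-1})$, $\Lambda(W)=\chi'(\Sigma(W))\subseteq\Sigma^*(W)$ and $\Lambda_I(W)=\chi'(D_I(W))$. For $I\subseteq S$ let $W_I=\langle I\rangle$, $W^I=\{w:D(w)\subseteq S\setminus I\}$, ${}^IW=\{w:D(w^{-1})\subseteq S\setminus I\}$, and write $w=w_I\cdot{}^Iw=w^I\cdot{}_Iw$ with $w_I,{}_Iw\in W_I$, ${}^Iw\in{}^IW$,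 $w^I\in W^I$. Define linear maps $\mu,\bar\mu:\mathbb{Z}W_I\to\mathbb{Z}W$ by $\mu(u)=W^I\cdot u$, $\bar\mu(u)=u\cdot{}^IW$, and $\rho,\bar\rho:\mathbb{Z}W\to\mathbb{Z}W_I$ by $\rho(w)=w_I$, $\bar\rho(w)={}_Iw$. 1. There is a unique bilinear form on $\Lambda(W)$ with $\langle\Lambda_I(W),\Lambda_J(W)\rangle=\#\{w\in W:D(w^{-1})=I,\ D(w)=J\}$ for all $I,J\subseteq S$. It is symmetric and nondegenerate. 2. Let $I\subseteq S$. The maps $\mu,\rho$ restrict to $\mu:\Sigma(W_I)\to\Sigma(W)$ and $\rho:\Sigma(W)\to\Sigma(W_I)$; the maps $\bar\mu,\bar\rho$ descend along $\chi$ to maps between $\Sigma^*(W_I)$ and $\Sigma^*(W)$, and these restrict to maps between $\Lambda(W_I)$ and $\Lambda(W)$. The diagram $$\begin{array}{ccccc} \Sigma(W_I)&\overset{\chi'}{\twoheadrightarrow}&\Lambda(W_I)&\overset{\imath}{\hookrightarrow}&\Sigma^*(W_I)\\ \downarrow{\scriptstyle\mu}&&\downarrow{\scriptstyle\bar\mu}&&\downarrow{\scriptstyle\bar\mu}\\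 \Sigma(W)&\overset{\chi'}{\twoheadrightarrow}&\Lambda(W)&\overset{\imath}{\hookrightarrow}&\Sigma^*(W)\\ \downarrow{\scriptstyle\rho}&&\downarrow{\scriptstyle\bar\rho}&&\downarrow{\scriptstyle\bar\rho}\\ \Sigma(W_I)&\overset{\chi'}{\twoheadrightarrow}&\Lambda(W_I)&\overset{\imath}{\hookrightarrow}&\Sigma^*(W_I) \end{array}$$ commutes, and rotating it by $180^\circ$ gives the dual diagram: with respect to the pairing of $\Sigma$ with $\Sigma^*$ and the forms on $\Lambda$, the map $\bar\rho$ on $\Sigma^*$ is dual to $\mu$ on $\Sigma$, the map $\bar\mu$ on $\Sigma^*$ is dual to $\rho$ on $\Sigma$, the maps $\bar\mu$ and $\bar\rho$ on $\Lambda$ are adjoint to each other, and in every row $\chi'$ and $\imath$ are adjoint to each other, i.e. $\langle\chi'(x),y\rangle=\imath(y)(x)$. 3. Let $\mathcal Cox$ be the category of finite Coxeter systems whose morphisms $(W',S')\to(W,S)$ are the injective group homomorphisms $f:W'\to W$ with $f(S')\subseteq S$; such an $f$ identifies $(W',S')$ with $(W_I,I)$ for $I=f(S')$, so the maps above are defined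 for $f$. Then $\Omega:(W,S)\mapsto\mathbb{Z}W$ (with $\mu$, respectively $\rho$), $\Sigma$ (with $\mu$, respectively $\rho$), $\Sigma^*$ and $\Lambda$ (each with $\bar\mu$, respectively $\bar\rho$) are functors from $\mathcal Cox$, respectively $\mathcal Cox^{op}$, to $\mathbb{Z}$-modules. In both cases the maps $\imath:\Sigma\hookrightarrow\Omega$, $\chi':\Omega\twoheadrightarrow\Sigma^*$, $\chi':\Sigma\twoheadrightarrow\Lambda$ and $\imath:\Lambda\hookrightarrow\Sigma^*$ are natural transformations, the first and last monic and the other two epic, and $\chi'\circ\imath=\imath\circ\chi'$ as maps $\Sigma\to\Sigma^*$. Moreover, for every morphism of $\mathcal Cox$, $\bar\rho$ and $\bar\mu$ on $\Sigma^*$ are the duals of $\mu$ and $\rho$ on $\Sigma$, and $\bar\mu$ and $\bar\rho$ on $\Lambda$ are adjoint with respect to the forms on $\Lambda$. -/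

import Mathlib

open CategoryTheory

universe u

noncomputable section

namespace CoxDescent

/-! ### Lengths, descents and minimal coset representatives

All notions below are relative to a pair `(W, S)` of a group and a set of generators. -/

section Pair

variable {W : Type u} [Group W]

/-- `(W, S)` is a Coxeter system: `W` has a Coxeter presentation on the set `S ⊆ W`. -/
def IsCoxeterSystem (S : Set W) : Prop :=
  ∃ (M : CoxeterMatrix S) (cs : CoxeterSystem M W), ∀ s : S, cs.simple s = s

/-- `ℓ(w)`, the least `k` such that `w` is a product of `k` elements of `S`. -/
def length (S : Set W) (w : W) : ℕ :=
  sInf {k | ∃ l : List W, (∀ s ∈ l, s ∈ S) ∧ l.prod = w ∧ l.length = k}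

/-- The descent set `D(w) = {s ∈ S : ℓ(ws) < ℓ(w)}`. -/
def descents (S : Set W) (w : W) : Set W :=
  {s | s ∈ S ∧ length S (w * s) < length S w}

/-- `W^I = {w : D(w) ⊆ S \ I}`. -/
def leftReps (S I : Set W) : Set W := {w | descents S w ⊆ S \ I}

/-- `^I W = {w : D(w⁻¹) ⊆ S \ I}`. -/
def rightReps (S I : Set W) : Set W := {w | descents S w⁻¹ ⊆ S \ I}

/-- The descent class `D_I(W) = {w : D(w) = I}`. -/
def descentClass (S I : Set W) : Set W := {w | descents S w = I}

/-- `c_{IJ} = #{w : D(w⁻¹) = I, D(w) = J}`. -/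
def descentCount (S I J : Set W) : ℕ :=
  Set.ncard {w | descents S w⁻¹ = I ∧ descents S w = J}

/-- The generating set `I` of `W_I = ⟨I⟩`, as a set of elements of the group `W_I`. -/
def parabolicGens (I : Set W) : Set (Subgroup.closure I) := {x | (x : W) ∈ I}

end Pair

/-! ### The group algebra, the descent algebra, its dual, and `Λ` -/

section Modules

variable {W : Type u} [Group W]

/-- The linear map on the integral group algebra with prescribed values on the group elements. -/
def linearExtend {N : Type*} [AddCommGroup N] (g : W → N) : MonoidAlgebra ℤ W →ₗ[ℤ] N :=
  (MonoidAlgebra.basis W ℤ).constr ℤ g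

theorem linearExtend_of {N : Type*} [AddCommGroup N] (g : W → N) (w : W) :
    linearExtend g (MonoidAlgebra.of ℤ W w) = g w := by
  have h := (MonoidAlgebra.basis W ℤ).constr_basis ℤ g w
  rwa [MonoidAlgebra.basis_apply] at h

/-- The `ℤ`-linear extension of `w ↦ w⁻¹`. -/
def invMap (W : Type u) [Group W] : MonoidAlgebra ℤ W →ₗ[ℤ] MonoidAlgebra ℤ W :=
  linearExtend fun w => MonoidAlgebra.of ℤ W w⁻¹

open scoped Classical in
/-- The form on the group algebra for which the group elements are orthonormal. -/
def groupForm (W : Type u) [Group W] :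
    MonoidAlgebra ℤ W →ₗ[ℤ] MonoidAlgebra ℤ W →ₗ[ℤ] ℤ :=
  linearExtend fun u => linearExtend fun v => if u = v then 1 else 0

variable [Finite W]

/-- The sum in the group algebra of the elements of a subset of `W`. -/
def setSum (A : Set W) : MonoidAlgebra ℤ W :=
  ∑ w ∈ A.toFinite.toFinset, MonoidAlgebra.of ℤ W w

/-- The descent algebra `Σ(W)`: the `ℤ`-span of the descent class sums `D_I(W)`, `I ⊆ S`. -/
def descentAlg (S : Set W) : Submodule ℤ (MonoidAlgebra ℤ W) :=
  Submodule.span ℤ {x | ∃ I ⊆ S, x = setSum (descentClass S I)}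

/-- `D_I(W)` as an element of `Σ(W)`. -/
def descentElt (S I : Set W) (hI : I ⊆ S) : descentAlg S :=
  ⟨setSum (descentClass S I), Submodule.subset_span ⟨I, hI, rfl⟩⟩

/-- The dual module `Σ*(W)`. -/
abbrev DescentDual (S : Set W) : Type u := Module.Dual ℤ (descentAlg S)

/-- `χ : ℤW → Σ*(W)`, dual to the inclusion of `Σ(W)` in the self-dual module `ℤW`. -/
def chi (S : Set W) : MonoidAlgebra ℤ W →ₗ[ℤ] DescentDual S :=
  (descentAlg S).subtype.dualMap ∘ₗ groupForm W

/-- `χ(w)` is the member `D*_{D(w)}` of the basis dual to the descent class sums. -/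
theorem chi_of_descentElt (S I : Set W) (hI : I ⊆ S) (w : W) [Decidable (descents S w = I)] :
    chi S (MonoidAlgebra.of ℤ W w) (descentElt S I hI) = if descents S w = I then 1 else 0 := by
  classical
  simp only [chi, LinearMap.comp_apply, LinearMap.dualMap_apply, Submodule.subtype_apply,
    descentElt, groupForm, setSum, linearExtend_of, map_sum]
  rw [Finset.sum_ite_eq]
  simp [descentClass]

/-- `χ' = χ ∘ ( )⁻¹ : ℤW → Σ*(W)`. -/
def chiInv (S : Set W) : MonoidAlgebra ℤ W →ₗ[ℤ] DescentDual S := chi S ∘ₗ invMap W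

/-- `Λ(W) = χ'(Σ(W))`. -/
def lam (S : Set W) : Submodule ℤ (DescentDual S) := (descentAlg S).map (chiInv S)

/-- `χ' : Σ(W) → Λ(W)`. -/
def chiLam (S : Set W) : descentAlg S →ₗ[ℤ] lam S :=
  (chiInv S).restrict fun _ hx => Submodule.mem_map_of_mem hx

/-- `Λ_I(W) = χ'(D_I(W))`. -/
def lamElt (S I : Set W) (hI : I ⊆ S) : lam S := chiLam S (descentElt S I hI)

/-- `B` is a bilinear form on `Λ(W)` with `⟨Λ_I, Λ_J⟩ = c_{IJ}` for all `I, J ⊆ S`. -/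
def IsLamForm (S : Set W) (B : LinearMap.BilinForm ℤ (lam S)) : Prop :=
  ∀ (I J : Set W) (hI : I ⊆ S) (hJ : J ⊆ S),
    B (lamElt S I hI) (lamElt S J hJ) = (descentCount S I J : ℤ)

end Modules

/-! ### Induced linear maps

A linear map between two modules that restricts to submodules, or descends to quotients, induces
a map there. The definitions below are total, with value zero if there is no induced map. -/

section Induced

variable {A B M N : Type*} [AddCommGroup A] [AddCommGroup B] [AddCommGroup M] [AddCommGroup N]
  [Module ℤ A] [Module ℤ B] [Module ℤ M] [Module ℤ N]

open scoped Classical in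
/-- The map `g'` with `j ∘ g' = g ∘ i`, for injections `i` and `j`, if there is one. -/
def restrictAlong (i : A →ₗ[ℤ] M) (j : B →ₗ[ℤ] N) (g : M →ₗ[ℤ] N) : A →ₗ[ℤ] B :=
  if h : ∃ g' : A →ₗ[ℤ] B, j ∘ₗ g' = g ∘ₗ i then h.choose else 0

open scoped Classical in
/-- The map `g'` with `g' ∘ p = q ∘ g`, for surjections `p` and `q`, if there is one. -/
def descendAlong (p : M →ₗ[ℤ] A) (q : N →ₗ[ℤ] B) (g : M →ₗ[ℤ] N) : A →ₗ[ℤ] B :=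
  if h : ∃ g' : A →ₗ[ℤ] B, g' ∘ₗ p = q ∘ₗ g then h.choose else 0

end Induced

/-! ### The maps `μ`, `ρ`, `μ̄`, `ρ̄`

Here `f : V → W` is an embedding of `(V, T)` in `(W, S)`, which identifies `(V, T)` with
`(W_I, I)` for `I = f(T)`. For `I ⊆ S` itself one takes `V = W_I`, `T = I` and the inclusion. -/

section Maps

variable {V W : Type u} [Group V] [Group W]

/-- `w_I ∈ W_I`, where `w = w_I · z` with `z ∈ ^I W`. -/
def leftFactor (f : V →* W) (T : Set V) (S : Set W) (w : W) : V :=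
  Classical.epsilon fun x => ∃ z ∈ rightReps S (f '' T), w = f x * z

/-- `_I w ∈ W_I`, where `w = z · _I w` with `z ∈ W^I`. -/
def rightFactor (f : V →* W) (T : Set V) (S : Set W) (w : W) : V :=
  Classical.epsilon fun x => ∃ z ∈ leftReps S (f '' T), w = z * f x

/-- `ρ : ℤW → ℤW_I`, `w ↦ w_I`. -/
def rho (f : V →* W) (T : Set V) (S : Set W) : MonoidAlgebra ℤ W →ₗ[ℤ] MonoidAlgebra ℤ V :=
  linearExtend fun w => MonoidAlgebra.of ℤ V (leftFactor f T S w)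

/-- `ρ̄ : ℤW → ℤW_I`, `w ↦ _I w`. -/
def rhoBar (f : V →* W) (T : Set V) (S : Set W) :
    MonoidAlgebra ℤ W →ₗ[ℤ] MonoidAlgebra ℤ V :=
  linearExtend fun w => MonoidAlgebra.of ℤ V (rightFactor f T S w)

variable [Finite W]

/-- `μ : ℤW_I → ℤW`, `u ↦ W^I · u`. -/
def mu (f : V →* W) (T : Set V) (S : Set W) : MonoidAlgebra ℤ V →ₗ[ℤ] MonoidAlgebra ℤ W :=
  linearExtend fun x => setSum (leftReps S (f '' T)) * MonoidAlgebra.of ℤ W (f x)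

/-- `μ̄ : ℤW_I → ℤW`, `u ↦ u · ^I W`. -/
def muBar (f : V →* W) (T : Set V) (S : Set W) :
    MonoidAlgebra ℤ V →ₗ[ℤ] MonoidAlgebra ℤ W :=
  linearExtend fun x => MonoidAlgebra.of ℤ W (f x) * setSum (rightReps S (f '' T))

variable [Finite V]

/-- `μ : Σ(W_I) → Σ(W)`, the restriction of `μ`. -/
def muSigma (f : V →* W) (T : Set V) (S : Set W) : descentAlg T →ₗ[ℤ] descentAlg S :=
  restrictAlong (descentAlg T).subtype (descentAlg S).subtype (mu f T S)

/-- `ρ : Σ(W) → Σ(W_I)`, the restriction of `ρ`. -/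
def rhoSigma (f : V →* W) (T : Set V) (S : Set W) : descentAlg S →ₗ[ℤ] descentAlg T :=
  restrictAlong (descentAlg S).subtype (descentAlg T).subtype (rho f T S)

/-- `μ̄ : Σ*(W_I) → Σ*(W)`, to which `μ̄` descends along `χ`. -/
def muBarDual (f : V →* W) (T : Set V) (S : Set W) : DescentDual T →ₗ[ℤ] DescentDual S :=
  descendAlong (chi T) (chi S) (muBar f T S)

/-- `ρ̄ : Σ*(W) → Σ*(W_I)`, to which `ρ̄` descends along `χ`. -/
def rhoBarDual (f : V →* W) (T : Set V) (S : Set W) : DescentDual S →ₗ[ℤ] DescentDual T :=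
  descendAlong (chi S) (chi T) (rhoBar f T S)

/-- `μ̄ : Λ(W_I) → Λ(W)`, the restriction of `μ̄ : Σ*(W_I) → Σ*(W)`. -/
def muBarLam (f : V →* W) (T : Set V) (S : Set W) : lam T →ₗ[ℤ] lam S :=
  restrictAlong (lam T).subtype (lam S).subtype (muBarDual f T S)

/-- `ρ̄ : Λ(W) → Λ(W_I)`, the restriction of `ρ̄ : Σ*(W) → Σ*(W_I)`. -/
def rhoBarLam (f : V →* W) (T : Set V) (S : Set W) : lam S →ₗ[ℤ] lam T :=
  restrictAlong (lam S).subtype (lam T).subtype (rhoBarDual f T S)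

end Maps

/-! ### The category of finite Coxeter systems -/

/-- A finite Coxeter system `(W, S)`. -/
structure Cox : Type (u + 1) where
  W : Type u
  [group : Group W]
  [finite : Finite W]
  S : Set W
  isCoxeterSystem : IsCoxeterSystem S

attribute [instance] Cox.group Cox.finite

/-- An embedding of Coxeter systems: an injective group homomorphism that carries the
generators of the source to generators of the target. -/
@[ext]
structure Cox.Hom (X Y : Cox.{u}) : Type u where
  hom : X.W →* Y.W
  injective : Function.Injective hom
  map_gen : ∀ s ∈ X.S, hom s ∈ Y.S

instance : Category.{u} Cox.{u} where
  Hom X Y := Cox.Hom X Y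
  id X := ⟨MonoidHom.id X.W, fun _ _ h => h, fun _ h => h⟩
  comp f g := ⟨g.hom.comp f.hom, fun _ _ h => f.injective (g.injective h),
    fun s h => g.map_gen _ (f.map_gen s h)⟩

/-- The assignment on objects and morphisms respects identities and compositions. -/
def IsFunctorial {C D : Type*} [Category C] [Category D] (P : C ⥤q D) : Prop :=
  (∀ X : C, P.map (𝟙 X) = 𝟙 (P.obj X)) ∧
  ∀ {X Y Z : C} (f : X ⟶ Y) (g : Y ⟶ Z), P.map (f ≫ g) = P.map f ≫ P.map g

/-- The functor with the given values on objects and morphisms. -/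
def toFunctor {C D : Type*} [Category C] [Category D] (P : C ⥤q D) (h : IsFunctorial P) :
    C ⥤ D where
  obj := P.obj
  map f := P.map f
  map_id := h.1
  map_comp := h.2

/-- `Ω` on the category of finite Coxeter systems: group algebras and the maps `μ`. -/
def Omega : Cox.{u} ⥤q ModuleCat.{u} ℤ where
  obj X := ModuleCat.of ℤ (MonoidAlgebra ℤ X.W)
  map {X Y} f := ModuleCat.ofHom (mu (Cox.Hom.hom f) X.S Y.S)

/-- `Ω` on the opposite category: group algebras and the maps `ρ`. -/
def OmegaOp : Cox.{u}ᵒᵖ ⥤q ModuleCat.{u} ℤ where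
  obj X := ModuleCat.of ℤ (MonoidAlgebra ℤ X.unop.W)
  map {X Y} f := ModuleCat.ofHom (rho (Cox.Hom.hom f.unop) Y.unop.S X.unop.S)

/-- `Σ` on the category of finite Coxeter systems: descent algebras and the maps `μ`. -/
def Sigma : Cox.{u} ⥤q ModuleCat.{u} ℤ where
  obj X := ModuleCat.of ℤ (descentAlg X.S)
  map {X Y} f := ModuleCat.ofHom (muSigma (Cox.Hom.hom f) X.S Y.S)

/-- `Σ` on the opposite category: descent algebras and the maps `ρ`. -/
def SigmaOp : Cox.{u}ᵒᵖ ⥤q ModuleCat.{u} ℤ where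
  obj X := ModuleCat.of ℤ (descentAlg X.unop.S)
  map {X Y} f := ModuleCat.ofHom (rhoSigma (Cox.Hom.hom f.unop) Y.unop.S X.unop.S)

/-- `Σ*` on the category of finite Coxeter systems: dual modules and the maps `μ̄`. -/
def SigmaDual : Cox.{u} ⥤q ModuleCat.{u} ℤ where
  obj X := ModuleCat.of ℤ (DescentDual X.S)
  map {X Y} f := ModuleCat.ofHom (muBarDual (Cox.Hom.hom f) X.S Y.S)

/-- `Σ*` on the opposite category: dual modules and the maps `ρ̄`. -/
def SigmaDualOp : Cox.{u}ᵒᵖ ⥤q ModuleCat.{u} ℤ where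
  obj X := ModuleCat.of ℤ (DescentDual X.unop.S)
  map {X Y} f := ModuleCat.ofHom (rhoBarDual (Cox.Hom.hom f.unop) Y.unop.S X.unop.S)

/-- `Λ` on the category of finite Coxeter systems, with the maps `μ̄`. -/
def Lambda : Cox.{u} ⥤q ModuleCat.{u} ℤ where
  obj X := ModuleCat.of ℤ (lam X.S)
  map {X Y} f := ModuleCat.ofHom (muBarLam (Cox.Hom.hom f) X.S Y.S)

/-- `Λ` on the opposite category, with the maps `ρ̄`. -/
def LambdaOp : Cox.{u}ᵒᵖ ⥤q ModuleCat.{u} ℤ where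
  obj X := ModuleCat.of ℤ (lam X.unop.S)
  map {X Y} f := ModuleCat.ofHom (rhoBarLam (Cox.Hom.hom f.unop) Y.unop.S X.unop.S)

end CoxDescent

end

/-! All of it comes down to coefficients in the group algebra and to two facts about descents. By
`mem_descentAlg_iff`, Σ(W) consists of the elements whose coefficients are constant on descent
classes. The unique factorization w = z · f(x) with z ∈ W^I makes μ adjoint to ρ̄ on group algebras
(`groupForm_mu`). Inversion exchanges μ with μ̄ and ρ with ρ̄, so μ̄ is adjoint to ρ
(`groupForm_muBar`).

The map μ preserves Σ because D(_I w) = D(w) ∩ I depends only on D(w) (`descents_rightFactor`). The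
map ρ preserves Σ because, for fixed y ∈ ^I W, D(xy) depends only on D(x) (`descents_mul_congr`,
from Deodhar's lemma). By adjointness, ρ̄ and μ̄ then descend along χ to the duals of μ and ρ on Σ.
Since χ' is χ after inversion, χ' carries μ to μ̄ and ρ to ρ̄, which gives the squares and the
restrictions to Λ.

On Σ the pairing χ'(x)(y) = ⟨x⁻¹, y⟩ is symmetric, so y(x), for y in Λ, depends on x only through
χ'(x). This defines the form on Λ. It is nondegenerate because an element of Λ pairing to zero with
every χ'(x) is the zero functional.

Functoriality is transitivity of the factorization (`rightFactor_comp`), carried to the other maps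
by inversion, adjointness, restriction and duality. The factorization and Deodhar's lemma rest on
the exchange condition, derived from the presentation through an action on W × ℤ/2. -/

noncomputable section

namespace CoxDescent

/-! ### The exchange condition -/

section Exchange

variable {B W : Type*} [Group W] {M : CoxeterMatrix B} (cs : CoxeterSystem M W)

open scoped Classical in
/-- The action of a simple reflection `s` on signed elements: conjugation by `s`, with a change
of sign at `s` itself. -/
def signedConj (i : B) : Function.End (W × ZMod 2) := fun p =>
  (cs.simple i * p.1 * cs.simple i, p.2 + if p.1 = cs.simple i then 1 else 0)

open scoped Classical in
-- Each further factor makes two more sign tests, one per reflection. Pulled back to the original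
-- `t`, they ask whether `t` is the next two of the elements `s_j (s_i s_j)^k`.
theorem signedConj_mul_pow (i j : B) (n : ℕ) (t : W) (e : ZMod 2) :
    ((signedConj cs i * signedConj cs j) ^ n : Function.End (W × ZMod 2)) (t, e) =
      ((cs.simple i * cs.simple j) ^ n * t * ((cs.simple i * cs.simple j) ^ n)⁻¹,
        e + ∑ k ∈ Finset.range (2 * n),
          if t = cs.simple j * (cs.simple i * cs.simple j) ^ k then 1 else 0) := by
  set a := cs.simple i with ha
  set b := cs.simple j with hb
  have hbb : b * b = 1 := cs.simple_mul_simple_self j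
  have ha' : a⁻¹ = a := cs.inv_simple i
  have hb' : b⁻¹ = b := cs.inv_simple j
  have hba : b * a = (a * b)⁻¹ := by rw [mul_inv_rev, ha', hb']
  -- Dihedral relation: conjugation by `b` inverts `a * b`.
  have hsc : ∀ k : ℕ, ((a * b) ^ k)⁻¹ * b = b * (a * b) ^ k := by
    intro k
    have h : b * (a * b) * b⁻¹ = (a * b)⁻¹ := by
      rw [← hba, hb', mul_assoc, mul_assoc, hbb, mul_one]
    rw [← inv_pow, ← h, conj_pow, hb', mul_assoc, hbb, mul_one]
  induction n with
  | zero => simp; rfl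
  | succ n ih =>
    rw [pow_succ']
    change (signedConj cs i * signedConj cs j)
      (((signedConj cs i * signedConj cs j) ^ n : Function.End (W × ZMod 2)) (t, e)) = _
    rw [ih]
    set r := (a * b) ^ n with hr
    change (a * (b * (r * t * r⁻¹) * b) * a,
      _ + (if r * t * r⁻¹ = b then 1 else 0) +
        (if b * (r * t * r⁻¹) * b = a then 1 else 0)) = _
    refine Prod.ext ?_ ?_
    · simp only [pow_succ', mul_inv_rev, ha', hb', ← hr, mul_assoc]
    · have h1 : (r * t * r⁻¹ = b) ↔ t = b * (a * b) ^ (2 * n) := by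
        rw [mul_inv_eq_iff_eq_mul, ← eq_inv_mul_iff_mul_eq, ← mul_assoc, hsc, mul_assoc, two_mul,
          pow_add]
      have h2 : (b * (r * t * r⁻¹) * b = a) ↔ t = b * (a * b) ^ (2 * n + 1) := by
        have e1 : b * (r * t * r⁻¹) * b = a ↔ r * t * r⁻¹ = b * (a * b) := by
          rw [← eq_mul_inv_iff_mul_eq, hb', ← eq_inv_mul_iff_mul_eq, hb']
        rw [e1, mul_inv_eq_iff_eq_mul, ← eq_inv_mul_iff_mul_eq, ← mul_assoc, ← mul_assoc, hsc,
          mul_assoc, mul_assoc, ← pow_succ', ← pow_add, two_mul, add_assoc]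
      simp only [h1, h2]
      rw [show 2 * (n + 1) = 2 * n + 1 + 1 by ring, Finset.sum_range_succ, Finset.sum_range_succ]
      ring

/-- At the exponent `M i j` the powers of `s_i s_j` are periodic, so the `2 * M i j` sign tests form
two equal halves and cancel modulo 2. -/
theorem signedConj_isLiftable : M.IsLiftable (signedConj cs) := by
  classical
  intro i j
  funext p
  obtain ⟨t, e⟩ := p
  rw [signedConj_mul_pow, cs.simple_mul_simple_pow, two_mul, Finset.sum_range_add]
  simp only [pow_add, cs.simple_mul_simple_pow, one_mul, inv_one, mul_one]
  rw [CharTwo.add_self_eq_zero, add_zero]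
  rfl

/-- The action of a Coxeter group on its signed elements. -/
def signedAction : W →* Function.End (W × ZMod 2) :=
  cs.lift ⟨signedConj cs, signedConj_isLiftable cs⟩

open scoped Classical in
-- The left side depends only on the group element, so the parity of the multiplicity of `t` in the
-- inversion sequence does not depend on the word.
theorem signedAction_wordProd (ω : List B) (t : W) :
    signedAction cs (cs.wordProd ω) (t, 0) =
      (cs.wordProd ω * t * (cs.wordProd ω)⁻¹, ((cs.rightInvSeq ω).count t : ZMod 2)) := by
  induction ω with
  | nil => simp; rfl
  | cons i ω ih =>
    rw [cs.wordProd_cons, map_mul]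
    change signedAction cs (cs.simple i) (signedAction cs (cs.wordProd ω) (t, 0)) = _
    rw [ih, signedAction, cs.lift_apply_simple]
    refine Prod.ext ?_ ?_
    · simp [signedConj, mul_assoc]
    · have h : (cs.wordProd ω * t * (cs.wordProd ω)⁻¹ = cs.simple i) ↔
          ((cs.wordProd ω)⁻¹ * cs.simple i * cs.wordProd ω = t) := by
        rw [mul_inv_eq_iff_eq_mul, ← eq_inv_mul_iff_mul_eq, ← mul_assoc, eq_comm]
      simp [signedConj, CoxeterSystem.rightInvSeq, List.count_cons, h]

/-- Compare `ω` with another word for the same element: a reduced word of `w s_i` followed by `i`.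
There `s_i` occurs exactly once, so by parity it occurs in the sequence of `ω`. -/
theorem mem_rightInvSeq_of_isRightDescent (ω : List B) (i : B)
    (h : cs.IsRightDescent (cs.wordProd ω) i) : cs.simple i ∈ cs.rightInvSeq ω := by
  classical
  obtain ⟨ω', hred, hω'⟩ := cs.exists_isReduced (cs.wordProd ω * cs.simple i)
  have hprod : cs.wordProd (ω'.concat i) = cs.wordProd ω := by
    rw [cs.wordProd_concat, ← hω', cs.simple_mul_simple_cancel_right]
  -- Otherwise `s_i` would shorten `w s_i`, whereas it is a descent of `w`.
  have hnot : cs.simple i ∉ cs.rightInvSeq ω' := by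
    intro hm
    have := (cs.isRightInversion_of_mem_rightInvSeq hred hm).2
    rw [← hω', cs.simple_mul_simple_cancel_right] at this
    exact absurd h (not_lt.2 this.le)
  have hcount : (cs.rightInvSeq (ω'.concat i)).count (cs.simple i) = 1 := by
    rw [cs.rightInvSeq_concat, List.concat_eq_append, List.count_append, List.count_singleton_self]
    have hc := List.count_map_of_injective (cs.rightInvSeq ω') _
      (MulAut.conj (cs.simple i)).injective (cs.simple i)
    rw [MulAut.conj_apply, mul_inv_cancel_right, List.count_eq_zero_of_not_mem hnot] at hc
    rw [hc]
  have key := congrArg Prod.snd (signedAction_wordProd cs (ω'.concat i) (cs.simple i))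
  rw [hprod, signedAction_wordProd, hcount] at key
  by_contra hmem
  rw [List.count_eq_zero_of_not_mem hmem] at key
  simp at key

theorem exists_eraseIdx_of_isRightDescent (ω : List B) (i : B)
    (h : cs.IsRightDescent (cs.wordProd ω) i) :
    ∃ k < ω.length, cs.wordProd ω * cs.simple i = cs.wordProd (ω.eraseIdx k) := by
  obtain ⟨k, hk, hki⟩ := List.mem_iff_getElem.1 (mem_rightInvSeq_of_isRightDescent cs ω i h)
  refine ⟨k, by simpa using hk, ?_⟩
  rw [← cs.wordProd_mul_getD_rightInvSeq, List.getD_eq_getElem _ _ hk, hki]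

end Exchange

/-! ### Lengths with respect to generating sets of involutions -/

section Length

variable {W : Type*} [Group W] {S : Set W}

/-- `S` is a generating set of involutions (or trivial elements). -/
structure IsInvolutiveGen (S : Set W) : Prop where
  mul_self : ∀ s ∈ S, s * s = 1
  closure_eq : Subgroup.closure S = ⊤

theorem length_prod_le {l : List W} (hl : ∀ s ∈ l, s ∈ S) : length S l.prod ≤ l.length :=
  Nat.sInf_le ⟨l, hl, rfl, rfl⟩

theorem length_one : length S (1 : W) = 0 := by
  simpa using length_prod_le (S := S) (l := []) (by simp)

theorem length_le_one {s : W} (hs : s ∈ S) : length S s ≤ 1 := by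
  simpa using length_prod_le (S := S) (l := [s]) (by simpa using hs)

namespace IsInvolutiveGen

variable (hS : IsInvolutiveGen S)
include hS

theorem inv_eq {s : W} (hs : s ∈ S) : s⁻¹ = s := inv_eq_of_mul_eq_one_left (hS.mul_self s hs)

theorem exists_list (w : W) : ∃ l : List W, (∀ s ∈ l, s ∈ S) ∧ l.prod = w := by
  have hw : w ∈ (Subgroup.closure S).toSubmonoid := hS.closure_eq ▸ Subgroup.mem_top w
  rw [Subgroup.closure_toSubmonoid] at hw
  obtain ⟨l, hl, rfl⟩ := Submonoid.exists_list_of_mem_closure hw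
  refine ⟨l, fun s hs => ?_, rfl⟩
  rcases hl s hs with h | h
  · exact h
  · rw [← inv_inv s, hS.inv_eq h]; exact h

theorem exists_reduced (w : W) :
    ∃ l : List W, (∀ s ∈ l, s ∈ S) ∧ l.prod = w ∧ l.length = length S w := by
  obtain ⟨l, hl, hw⟩ := hS.exists_list w
  exact Nat.sInf_mem (s := {k | ∃ l : List W, (∀ s ∈ l, s ∈ S) ∧ l.prod = w ∧ l.length = k})
    ⟨_, l, hl, hw, rfl⟩

theorem length_mul_le (v w : W) : length S (v * w) ≤ length S v + length S w := by
  obtain ⟨l, hl, rfl, hl'⟩ := hS.exists_reduced v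
  obtain ⟨m, hm, rfl, hm'⟩ := hS.exists_reduced w
  rw [← hl', ← hm', ← List.prod_append, ← List.length_append]
  refine length_prod_le fun s hs => ?_
  rcases List.mem_append.1 hs with h | h
  exacts [hl s h, hm s h]

theorem length_inv_le (w : W) : length S w⁻¹ ≤ length S w := by
  obtain ⟨l, hl, rfl, hl'⟩ := hS.exists_reduced w
  have hmap : l.map (fun x => x⁻¹) = l := by
    conv_rhs => rw [← List.map_id l]
    exact List.map_congr_left fun s hs => hS.inv_eq (hl s hs)
  rw [← hl', List.prod_inv_reverse, hmap, ← List.length_reverse]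
  exact length_prod_le fun s hs => hl s (List.mem_reverse.1 hs)

theorem length_inv (w : W) : length S w⁻¹ = length S w :=
  le_antisymm (hS.length_inv_le w) (by simpa using hS.length_inv_le w⁻¹)

theorem eq_one_of_length_eq_zero {w : W} (hw : length S w = 0) : w = 1 := by
  obtain ⟨l, hl, rfl, hl'⟩ := hS.exists_reduced w
  rw [hw, List.length_eq_zero_iff] at hl'
  rw [hl', List.prod_nil]

theorem length_mul_le_add_one (w : W) {s : W} (hs : s ∈ S) :
    length S (w * s) ≤ length S w + 1 :=
  (hS.length_mul_le w s).trans (Nat.add_le_add_left (length_le_one hs) _)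

theorem length_le_mul_add_one (w : W) {s : W} (hs : s ∈ S) :
    length S w ≤ length S (w * s) + 1 := by
  simpa [mul_assoc, hS.mul_self s hs] using hS.length_mul_le_add_one (w * s) hs

theorem exists_mem_descents {w : W} (hw : w ≠ 1) : ∃ s ∈ S, length S (w * s) < length S w := by
  obtain ⟨l, hl, rfl, hl'⟩ := hS.exists_reduced w
  rcases List.eq_nil_or_concat' l with rfl | ⟨m, s, rfl⟩
  · simp at hw
  · have hs : s ∈ S := hl s (by simp)
    refine ⟨s, hs, ?_⟩
    rw [← hl', List.prod_append, List.prod_singleton, mul_assoc, hS.mul_self s hs, mul_one]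
    refine (length_prod_le fun t ht => hl t (by simp [ht])).trans_lt ?_
    simp

end IsInvolutiveGen

namespace IsCoxeterSystem

theorem involutiveGen (hS : IsCoxeterSystem S) : IsInvolutiveGen S := by
  obtain ⟨M, cs, hcs⟩ := hS
  refine ⟨fun s hs => ?_, ?_⟩
  · simpa [hcs] using cs.simple_mul_simple_self ⟨s, hs⟩
  · rw [← cs.subgroup_closure_range_simple]
    congr 1
    ext s
    simp [hcs]

theorem length_eq {M : CoxeterMatrix S} {cs : CoxeterSystem M W} (hcs : ∀ s : S, cs.simple s = s)
    (w : W) : length S w = cs.length w := by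
  have hmap : ∀ ω : List S, cs.wordProd ω = (ω.map Subtype.val).prod := by
    intro ω
    rw [CoxeterSystem.wordProd, funext hcs]
  apply le_antisymm
  · obtain ⟨ω, hred, rfl⟩ := cs.exists_isReduced w
    rw [hred.eq, hmap, ← List.length_map (as := ω) (f := Subtype.val)]
    exact length_prod_le (by simp +contextual)
  · obtain ⟨l, hl, rfl, hl'⟩ := (involutiveGen ⟨M, cs, hcs⟩).exists_reduced w
    lift l to List S using hl
    rw [← hl', ← hmap, List.length_map]
    exact cs.length_wordProd_le l

theorem length_mul_ne (hS : IsCoxeterSystem S) (w : W) {s : W} (hs : s ∈ S) :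
    length S (w * s) ≠ length S w := by
  obtain ⟨M, cs, hcs⟩ := hS
  rw [length_eq hcs, length_eq hcs]
  simpa [hcs] using cs.length_mul_simple_ne w ⟨s, hs⟩

/-- The exchange condition. -/
theorem exchange (hS : IsCoxeterSystem S) {l : List W} (hl : ∀ s ∈ l, s ∈ S) {s : W} (hs : s ∈ S)
    (h : length S (l.prod * s) < length S l.prod) :
    ∃ k < l.length, l.prod * s = (l.eraseIdx k).prod := by
  obtain ⟨M, cs, hcs⟩ := hS
  have hmap : ∀ ω : List S, cs.wordProd ω = (ω.map Subtype.val).prod := by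
    intro ω
    rw [CoxeterSystem.wordProd, funext hcs]
  rw [length_eq hcs, length_eq hcs] at h
  lift l to List S using hl
  lift s to S using hs
  rw [← hmap, ← hcs s] at h ⊢
  obtain ⟨k, hk, hkl⟩ := exists_eraseIdx_of_isRightDescent cs l s h
  refine ⟨k, by simpa using hk, ?_⟩
  rw [hkl, hmap, List.eraseIdx_map]

end IsCoxeterSystem

end Length

/-! ### Parabolic factorizations -/

section Parabolic

variable {V W : Type u} [Group V] [Group W]

/-- `f` identifies the group `V`, generated by `T`, with a parabolic subgroup of the Coxeter
system `(W, S)`. -/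
structure IsParabolicEmbedding (f : V →* W) (T : Set V) (S : Set W) : Prop where
  injective : Function.Injective f
  map_gen : ∀ t ∈ T, f t ∈ S
  closure_eq : Subgroup.closure T = ⊤
  isCoxeterSystem : IsCoxeterSystem S

namespace IsParabolicEmbedding

variable {f : V →* W} {T : Set V} {S : Set W}

theorem mem_rightReps {z : W} : z ∈ rightReps S (f '' T) ↔ z⁻¹ ∈ leftReps S (f '' T) := Iff.rfl

theorem exists_minimal_factor (w : W) :
    ∃ z : W, (∀ x, length S z ≤ length S (z * f x)) ∧ ∃ x : V, w = z * f x := by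
  obtain ⟨x, hx⟩ := Nat.sInf_mem (Set.range_nonempty fun x : V => length S (w * f x))
  refine ⟨w * f x, fun y => ?_, x⁻¹, by simp⟩
  change length S (w * f x) = _ at hx
  rw [hx, mul_assoc, ← map_mul]
  exact Nat.sInf_le ⟨x * y, rfl⟩

variable (h : IsParabolicEmbedding f T S)
include h

theorem gen : IsInvolutiveGen S := h.isCoxeterSystem.involutiveGen

/-- Generation by such elements is all that is needed of `T` as a generating set; no Coxeter
presentation of the parabolic subgroup enters. -/
theorem source_gen : IsInvolutiveGen T where
  mul_self t ht := h.injective (by rw [map_mul, map_one, h.gen.mul_self _ (h.map_gen t ht)])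
  closure_eq := h.closure_eq

/-- A generator always changes the length, so not being a descent is the same as being a strict
ascent. -/
theorem mem_leftReps {z : W} :
    z ∈ leftReps S (f '' T) ↔ ∀ t ∈ T, length S z < length S (z * f t) := by
  constructor
  · intro hz t ht
    by_contra hlt
    exact (hz ⟨h.map_gen t ht, lt_of_le_of_ne (not_lt.1 hlt)
      (h.isCoxeterSystem.length_mul_ne z (h.map_gen t ht))⟩).2 ⟨t, ht, rfl⟩
  · rintro hz s ⟨hs, hlt⟩
    refine ⟨hs, ?_⟩
    rintro ⟨t, ht, rfl⟩
    exact absurd (hz t ht) (not_lt.2 hlt.le)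

/-- Append the letters one at a time. If a letter failed to lengthen the product, exchange would
delete a letter either from a word of `z` or from the word in `T`; minimality of `z` excludes the
first, reducedness the second. -/
theorem length_mul_list_of_minimal {z : W} (hz : ∀ x, length S z ≤ length S (z * f x))
    (l : List V) (hl : ∀ t ∈ l, t ∈ T) (hred : length T l.prod = l.length) :
    length S (z * f l.prod) = length S z + l.length := by
  induction l using List.reverseRecOn with
  | nil => simp
  | append_singleton m t ih =>
    have hm : ∀ s ∈ m, s ∈ T := fun s hs => hl s (by simp [hs])
    have ht : t ∈ T := hl t (by simp)
    have hft := h.map_gen t ht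
    rw [List.prod_append, List.prod_singleton, List.length_append, List.length_singleton] at *
    have hmred : length T m.prod = m.length := by
      have h1 := h.source_gen.length_mul_le_add_one m.prod ht
      have h2 := length_prod_le hm
      omega
    have ih := ih hm hmred
    rw [map_mul, ← mul_assoc]
    by_contra hne
    have h1 := h.gen.length_mul_le_add_one (z * f m.prod) hft
    have h2 := h.isCoxeterSystem.length_mul_ne (z * f m.prod) hft
    obtain ⟨a, ha, hap, hal⟩ := h.gen.exists_reduced z
    have hprod : (a ++ m.map f).prod = z * f m.prod := by
      rw [List.prod_append, hap, map_list_prod]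
    have hmem : ∀ s ∈ a ++ m.map f, s ∈ S := by
      intro s hs
      rcases List.mem_append.1 hs with hs | hs
      · exact ha s hs
      · obtain ⟨x, hx, rfl⟩ := List.mem_map.1 hs
        exact h.map_gen x (hm x hx)
    obtain ⟨k, hk, hke⟩ := h.isCoxeterSystem.exchange hmem hft (by rw [hprod]; omega)
    rw [hprod] at hke
    rcases lt_or_ge k a.length with hka | hka
    -- The shortened word of `z` represents an element of the coset `z * f V` that is shorter than
    -- `z`.
    · rw [List.eraseIdx_append_of_lt_length hka, List.prod_append, ← map_list_prod] at hke
      have h3 : z * f (m.prod * t * m.prod⁻¹) = (a.eraseIdx k).prod := by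
        rw [map_mul, map_mul, map_inv, ← mul_assoc, ← mul_assoc, hke, mul_inv_cancel_right]
      have h4 := hz (m.prod * t * m.prod⁻¹)
      have h5 : length S (a.eraseIdx k).prod ≤ (a.eraseIdx k).length :=
        length_prod_le fun s hs => ha s (List.mem_of_mem_eraseIdx hs)
      have h6 := List.length_eraseIdx_add_one hka
      rw [h3] at h4
      omega
    -- Cancelling `z` and using injectivity of `f` leaves a word in `T` for `m.prod * t` with fewer
    -- than `m.length + 1` letters.
    · rw [List.eraseIdx_append_of_length_le hka, List.prod_append, hap, List.eraseIdx_map,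
        ← map_list_prod, mul_assoc, mul_left_cancel_iff, ← map_mul] at hke
      have h3 := h.injective hke
      have h5 : length T (m.eraseIdx (k - a.length)).prod ≤ (m.eraseIdx (k - a.length)).length :=
        length_prod_le fun s hs => hm s (List.mem_of_mem_eraseIdx hs)
      have h6 : (m.eraseIdx (k - a.length)).length ≤ m.length := List.length_eraseIdx_le _ _
      rw [h3] at hred
      omega

theorem length_mul_of_minimal {z : W} (hz : ∀ x, length S z ≤ length S (z * f x)) (x : V) :
    length S (z * f x) = length S z + length T x := by
  obtain ⟨l, hl, rfl, hlen⟩ := h.source_gen.exists_reduced x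
  rw [h.length_mul_list_of_minimal hz l hl hlen.symm, hlen]

/-- Local minimality implies global minimality: write `z = z₀ * f y` with `z₀` shortest in its
coset. A descent of `y ≠ 1` would, by additivity of lengths, be a descent of `z`. -/
theorem minimal_of_mem_leftReps {z : W} (hz : z ∈ leftReps S (f '' T)) (x : V) :
    length S z ≤ length S (z * f x) := by
  obtain ⟨z₀, hmin, y, rfl⟩ := exists_minimal_factor (S := S) (f := f) z
  suffices hy : y = 1 by
    subst hy
    simpa using hmin x
  by_contra hy
  obtain ⟨t, ht, hlt⟩ := h.source_gen.exists_mem_descents hy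
  have h1 := h.mem_leftReps.1 hz t ht
  rw [mul_assoc, ← map_mul, h.length_mul_of_minimal hmin, h.length_mul_of_minimal hmin] at h1
  omega

theorem length_mul {z : W} (hz : z ∈ leftReps S (f '' T)) (x : V) :
    length S (z * f x) = length S z + length T x :=
  h.length_mul_of_minimal (h.minimal_of_mem_leftReps hz) x

theorem exists_factor (w : W) : ∃ x, ∃ z ∈ leftReps S (f '' T), w = z * f x := by
  obtain ⟨z, hmin, x, hx⟩ := exists_minimal_factor (S := S) (f := f) w
  refine ⟨x, z, h.mem_leftReps.2 fun t ht => lt_of_le_of_ne (hmin t) ?_, hx⟩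
  exact (h.isCoxeterSystem.length_mul_ne z (h.map_gen t ht)).symm

/-- Each of `z`, `z'` is the other times an element of `f V`. Additivity in both directions forces
these elements to have length zero. -/
theorem factor_unique {z z' : W} (hz : z ∈ leftReps S (f '' T)) (hz' : z' ∈ leftReps S (f '' T))
    {x x' : V} (hx : z * f x = z' * f x') : x = x' := by
  have e1 : z = z' * f (x' * x⁻¹) := by
    rw [map_mul, map_inv, ← mul_assoc, ← hx, mul_inv_cancel_right]
  have e2 : z' = z * f (x * x'⁻¹) := by
    rw [map_mul, map_inv, ← mul_assoc, hx, mul_inv_cancel_right]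
  have h1 := h.length_mul hz' (x' * x⁻¹)
  have h2 := h.length_mul hz (x * x'⁻¹)
  rw [← e1] at h1
  rw [← e2] at h2
  have h3 : length T (x * x'⁻¹) = 0 := by omega
  exact mul_inv_eq_one.1 (h.source_gen.eq_one_of_length_eq_zero h3)

theorem rightFactor_eq {z : W} (hz : z ∈ leftReps S (f '' T)) (x : V) :
    rightFactor f T S (z * f x) = x := by
  obtain ⟨z', hz', he⟩ := Classical.epsilon_spec
    (p := fun y => ∃ z' ∈ leftReps S (f '' T), z * f x = z' * f y) ⟨x, z, hz, rfl⟩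
  exact h.factor_unique hz' hz he.symm

theorem exists_mul_rightFactor (w : W) :
    ∃ z ∈ leftReps S (f '' T), w = z * f (rightFactor f T S w) :=
  Classical.epsilon_spec (h.exists_factor w)

/-- Inversion exchanges the two kinds of coset representatives, so left factors need no theory of
their own. -/
theorem leftFactor_eq_inv (w : W) : leftFactor f T S w = (rightFactor f T S w⁻¹)⁻¹ := by
  obtain ⟨x, z, hz, hw⟩ := h.exists_factor w⁻¹
  have hw' : w = f x⁻¹ * z⁻¹ := by rw [map_inv, ← mul_inv_rev, ← hw, inv_inv]
  obtain ⟨z', hz', he⟩ := Classical.epsilon_spec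
    (p := fun y => ∃ z' ∈ rightReps S (f '' T), w = f y * z')
    ⟨x⁻¹, z⁻¹, by rwa [mem_rightReps, inv_inv], hw'⟩
  rw [hw, h.rightFactor_eq hz]
  change leftFactor f T S w = _
  have he' : w = f (leftFactor f T S w) * z' := he
  have h2 : w⁻¹ = z'⁻¹ * f (leftFactor f T S w)⁻¹ := by
    rw [map_inv, ← mul_inv_rev, ← he']
  rw [hw] at h2
  rw [h.factor_unique hz hz' h2, inv_inv]

theorem mem_descents_mul {z : W} (hz : z ∈ leftReps S (f '' T)) (x : V) {t : V} (ht : t ∈ T) :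
    f t ∈ descents S (z * f x) ↔ t ∈ descents T x := by
  simp only [descents, Set.mem_ofPred_eq, h.map_gen t ht, ht, true_and]
  rw [mul_assoc, ← map_mul, h.length_mul hz, h.length_mul hz]
  omega

/-- The length of the representative cancels from both sides of the descent condition. Since the
result depends only on `descents S w`, `mu` will preserve Σ. -/
theorem descents_rightFactor (w : W) :
    descents T (rightFactor f T S w) = {t | t ∈ T ∧ f t ∈ descents S w} := by
  obtain ⟨z, hz, hw⟩ := h.exists_mul_rightFactor w
  ext t
  constructor
  · intro ht
    refine ⟨ht.1, ?_⟩
    rw [hw]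
    exact (h.mem_descents_mul hz _ ht.1).2 ht
  · rintro ⟨ht, hd⟩
    rw [hw] at hd
    exact (h.mem_descents_mul hz _ ht).1 hd

/-! ### Products with representatives from ^I W, and their descents -/

theorem length_mul_rightReps {y : W} (hy : y ∈ rightReps S (f '' T)) (x : V) :
    length S (f x * y) = length T x + length S y := by
  rw [← h.gen.length_inv, mul_inv_rev, ← map_inv, h.length_mul hy, h.gen.length_inv,
    h.source_gen.length_inv, add_comm]

theorem mem_rightReps_iff {z : W} :
    z ∈ rightReps S (f '' T) ↔ ∀ t ∈ T, length S z < length S (f t * z) := by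
  rw [mem_rightReps, h.mem_leftReps]
  refine forall₂_congr fun t ht => ?_
  rw [h.gen.length_inv, ← h.gen.length_inv (f t * z), mul_inv_rev, h.gen.inv_eq (h.map_gen t ht)]

/-- Deodhar's lemma. -/
theorem mul_mem_rightReps_or {y : W} (hy : y ∈ rightReps S (f '' T)) {s : W} (hs : s ∈ S) :
    y * s ∈ rightReps S (f '' T) ∨ ∃ t ∈ T, y * s = f t * y := by
  by_cases hys : y * s ∈ rightReps S (f '' T)
  · exact Or.inl hys
  right
  rw [h.mem_rightReps_iff] at hys
  push Not at hys
  obtain ⟨t, ht, hle⟩ := hys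
  have hft := h.map_gen t ht
  refine ⟨t, ht, ?_⟩
  have hty := h.mem_rightReps_iff.1 hy t ht
  have hne : length S (f t * (y * s)) ≠ length S (y * s) := by
    rw [← h.gen.length_inv, ← h.gen.length_inv (y * s), mul_inv_rev, h.gen.inv_eq hft]
    exact h.isCoxeterSystem.length_mul_ne _ hft
  have hty1 : length S (f t * y) ≤ 1 + length S y :=
    (h.gen.length_mul_le _ _).trans (Nat.add_le_add_right (length_le_one hft) _)
  have hlow := h.gen.length_le_mul_add_one (f t * y) hs
  have hup := h.gen.length_mul_le_add_one y hs
  rw [← mul_assoc] at hle hne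
  obtain ⟨a, ha, hap, hal⟩ := h.gen.exists_reduced y
  have hprod : (f t :: a).prod = f t * y := by rw [List.prod_cons, hap]
  -- The inequalities force ℓ(ys) = ℓ(y) + 1 and make `s` a descent of `f t * y`. Deleting the head
  -- `f t` gives the claim; deleting a letter of `a` would make `y * s` shorter than `y`.
  obtain ⟨k, hk, hke⟩ := h.isCoxeterSystem.exchange (l := f t :: a)
    (by simpa [hft] using ha) hs (by rw [hprod]; omega)
  rw [hprod] at hke
  rcases k with _ | k
  · rw [List.eraseIdx_zero, List.tail_cons, hap] at hke
    nth_rw 2 [← hke]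
    rw [← mul_assoc, ← mul_assoc, h.gen.mul_self _ hft, one_mul]
  · rw [List.eraseIdx_cons_succ, List.prod_cons, mul_assoc, mul_left_cancel_iff] at hke
    have h5 : length S (a.eraseIdx k).prod ≤ (a.eraseIdx k).length :=
      length_prod_le fun s hs => ha s (List.mem_of_mem_eraseIdx hs)
    have h6 := List.length_eraseIdx_add_one (l := a) (i := k) (by simpa using hk)
    rw [← hke] at h5
    omega

/-- Apply Deodhar's lemma to each `s`. If `y * s` is again a representative, additivity makes the
condition on `s` independent of `x`. If `y * s = f t * y`, it becomes `t ∈ descents T x`. -/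
theorem descents_mul_congr {y : W} (hy : y ∈ rightReps S (f '' T)) {x x' : V}
    (hx : descents T x = descents T x') : descents S (f x * y) = descents S (f x' * y) := by
  have key : ∀ (s : W), s ∈ S → (∃ t ∈ T, ∀ x : V, s ∈ descents S (f x * y) ↔ t ∈ descents T x) ∨
      ∃ p : Prop, ∀ x : V, s ∈ descents S (f x * y) ↔ p := by
    intro s hs
    rcases h.mul_mem_rightReps_or hy hs with hys | ⟨t, ht, he⟩
    · refine Or.inr ⟨length S (y * s) < length S y, fun x => ?_⟩
      simp only [descents, Set.mem_ofPred_eq, hs, true_and]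
      rw [mul_assoc, h.length_mul_rightReps hys, h.length_mul_rightReps hy]
      omega
    · refine Or.inl ⟨t, ht, fun x => ?_⟩
      simp only [descents, Set.mem_ofPred_eq, hs, ht, true_and]
      rw [mul_assoc, he, ← mul_assoc, ← map_mul, h.length_mul_rightReps hy,
        h.length_mul_rightReps hy]
      omega
  ext s
  by_cases hs : s ∈ S
  · rcases key s hs with ⟨t, -, ht⟩ | ⟨p, hp⟩
    · rw [ht, ht, hx]
    · rw [hp, hp]
  · exact ⟨fun hd => absurd hd.1 hs, fun hd => absurd hd.1 hs⟩

/-! #### Identities and compositions -/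

theorem comp {U : Type u} [Group U] {g : U →* V} {R : Set U}
    (hg : IsParabolicEmbedding g R T) : IsParabolicEmbedding (f.comp g) R S :=
  ⟨h.injective.comp hg.injective, fun r hr => h.map_gen _ (hg.map_gen r hr), hg.closure_eq,
    h.isCoxeterSystem⟩

/-- Factor in two stages. The product of the two representatives is a representative for the
composite, so uniqueness identifies the factors. -/
theorem rightFactor_comp {U : Type u} [Group U] {g : U →* V} {R : Set U}
    (hg : IsParabolicEmbedding g R T) (w : W) :
    rightFactor (f.comp g) R S w = rightFactor g R T (rightFactor f T S w) := by
  have hfg := h.comp hg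
  obtain ⟨z, hz, hw⟩ := h.exists_mul_rightFactor w
  set v := rightFactor f T S w
  obtain ⟨y, hy, hv⟩ := hg.exists_mul_rightFactor v
  set x := rightFactor g R T v
  have hzy : z * f y ∈ leftReps S (f.comp g '' R) := by
    rw [hfg.mem_leftReps]
    intro r hr
    rw [MonoidHom.comp_apply, mul_assoc, ← map_mul, h.length_mul hz, h.length_mul hz]
    exact Nat.add_lt_add_left (hg.mem_leftReps.1 hy r hr) _
  have hwx : w = z * f y * f.comp g x := by
    rw [hw, hv, map_mul, mul_assoc, MonoidHom.comp_apply]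
  rw [hwx, hfg.rightFactor_eq hzy]

end IsParabolicEmbedding

/-! ### Identities, parabolic subgroups and morphisms of `Cox` as parabolic embeddings -/

theorem IsCoxeterSystem.isParabolicEmbedding_id {S : Set W} (hS : IsCoxeterSystem S) :
    IsParabolicEmbedding (MonoidHom.id W) S S :=
  ⟨Function.injective_id, fun _ h => h, hS.involutiveGen.closure_eq, hS⟩

theorem IsCoxeterSystem.rightFactor_id {S : Set W} (hS : IsCoxeterSystem S) (w : W) :
    rightFactor (MonoidHom.id W) S S w = w := by
  have h := hS.isParabolicEmbedding_id
  have h1 : (1 : W) ∈ leftReps S (MonoidHom.id W '' S) := by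
    rintro s ⟨-, hlt⟩
    rw [length_one] at hlt
    exact absurd hlt (Nat.not_lt_zero _)
  simpa using h.rightFactor_eq h1 w

theorem isParabolicEmbedding_subtype {S : Set W} (hS : IsCoxeterSystem S) {I : Set W}
    (hI : I ⊆ S) :
    IsParabolicEmbedding (Subgroup.closure I).subtype (parabolicGens I) S :=
  ⟨Subtype.val_injective, fun _ ht => hI ht, Subgroup.closure_closure_coe_preimage, hS⟩

theorem Cox.Hom.isParabolicEmbedding {X Y : Cox.{u}} (e : X ⟶ Y) :
    IsParabolicEmbedding (Cox.Hom.hom e) X.S Y.S :=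
  ⟨e.injective, e.map_gen, X.isCoxeterSystem.involutiveGen.closure_eq, Y.isCoxeterSystem⟩

end Parabolic

/-! ### The form on the group algebra -/

section GroupForm

variable {W : Type u} [Group W]

theorem linearMap_ext_of {N : Type*} [AddCommGroup N] {g h : MonoidAlgebra ℤ W →ₗ[ℤ] N}
    (hgh : ∀ w, g (MonoidAlgebra.of ℤ W w) = h (MonoidAlgebra.of ℤ W w)) : g = h := by
  refine (MonoidAlgebra.basis W ℤ).ext fun w => ?_
  rw [MonoidAlgebra.basis_apply]
  exact hgh w

open scoped Classical in
theorem groupForm_of_of (v w : W) :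
    groupForm W (MonoidAlgebra.of ℤ W v) (MonoidAlgebra.of ℤ W w) = if v = w then 1 else 0 := by
  simp only [groupForm, linearExtend_of]

theorem groupForm_comm (x y : MonoidAlgebra ℤ W) : groupForm W x y = groupForm W y x := by
  classical
  suffices h : groupForm W = (groupForm W).flip by
    conv_lhs => rw [h]
    rfl
  refine linearMap_ext_of fun v => linearMap_ext_of fun w => ?_
  rw [LinearMap.flip_apply, groupForm_of_of, groupForm_of_of]
  simp only [eq_comm]

theorem groupForm_of_left (w : W) (x : MonoidAlgebra ℤ W) :
    groupForm W (MonoidAlgebra.of ℤ W w) x = (MonoidAlgebra.basis W ℤ).repr x w := by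
  classical
  suffices h : groupForm W (MonoidAlgebra.of ℤ W w) = (MonoidAlgebra.basis W ℤ).coord w by
    rw [h]; rfl
  refine linearMap_ext_of fun v => ?_
  have hv : MonoidAlgebra.of ℤ W v = MonoidAlgebra.basis W ℤ v := by
    rw [MonoidAlgebra.basis_apply]
    rfl
  rw [groupForm_of_of, Module.Basis.coord_apply, hv, Module.Basis.repr_self,
    Finsupp.single_apply]
  simp only [eq_comm]

theorem ext_groupForm {x y : MonoidAlgebra ℤ W}
    (h : ∀ w, groupForm W (MonoidAlgebra.of ℤ W w) x = groupForm W (MonoidAlgebra.of ℤ W w) y) :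
    x = y := by
  refine (MonoidAlgebra.basis W ℤ).ext_elem fun w => ?_
  rw [← groupForm_of_left, ← groupForm_of_left, h]

theorem invMap_of (w : W) :
    invMap W (MonoidAlgebra.of ℤ W w) = MonoidAlgebra.of ℤ W w⁻¹ := linearExtend_of _ _

theorem invMap_invMap (x : MonoidAlgebra ℤ W) : invMap W (invMap W x) = x := by
  suffices h : invMap W ∘ₗ invMap W = LinearMap.id from LinearMap.congr_fun h x
  refine linearMap_ext_of fun w => ?_
  rw [LinearMap.comp_apply, invMap_of, invMap_of, inv_inv, LinearMap.id_apply]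

theorem invMap_surjective : Function.Surjective (invMap W) := fun x => ⟨_, invMap_invMap x⟩

theorem groupForm_invMap (x y : MonoidAlgebra ℤ W) :
    groupForm W (invMap W x) y = groupForm W x (invMap W y) := by
  classical
  suffices h : groupForm W ∘ₗ invMap W = (groupForm W).compl₂ (invMap W) from
    LinearMap.congr_fun (LinearMap.congr_fun h x) y
  refine linearMap_ext_of fun v => linearMap_ext_of fun w => ?_
  rw [LinearMap.comp_apply, LinearMap.compl₂_apply, invMap_of, invMap_of, groupForm_of_of,
    groupForm_of_of]
  simp only [inv_eq_iff_eq_inv]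

variable [Finite W]

open scoped Classical in
theorem groupForm_of_setSum (w : W) (A : Set W) :
    groupForm W (MonoidAlgebra.of ℤ W w) (setSum A) = if w ∈ A then 1 else 0 := by
  simp only [setSum, map_sum, groupForm_of_of]
  rw [Finset.sum_ite_eq]
  simp

theorem setSum_mul_of (A : Set W) (w : W) :
    setSum A * MonoidAlgebra.of ℤ W w = setSum {v | ∃ a ∈ A, v = a * w} := by
  classical
  simp only [setSum, Finset.sum_mul, ← map_mul]
  refine Finset.sum_bij (fun a _ => a * w) ?_ ?_ ?_ ?_
  · intro a ha
    simpa using ha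
  · intro a _ b _ hab
    exact mul_right_cancel hab
  · intro b hb
    obtain ⟨a, ha, rfl⟩ := (Set.Finite.mem_toFinset _).1 hb
    exact ⟨a, by simpa using ha, rfl⟩
  · intro a _
    rfl

theorem of_mul_setSum (A : Set W) (w : W) :
    MonoidAlgebra.of ℤ W w * setSum A = setSum {v | ∃ a ∈ A, v = w * a} := by
  classical
  simp only [setSum, Finset.mul_sum, ← map_mul]
  refine Finset.sum_bij (fun a _ => w * a) ?_ ?_ ?_ ?_
  · intro a ha
    simpa using ha
  · intro a _ b _ hab
    exact mul_left_cancel hab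
  · intro b hb
    obtain ⟨a, ha, rfl⟩ := (Set.Finite.mem_toFinset _).1 hb
    exact ⟨a, by simpa using ha, rfl⟩
  · intro a _
    rfl

theorem invMap_setSum (A : Set W) : invMap W (setSum A) = setSum {v | v⁻¹ ∈ A} := by
  classical
  refine ext_groupForm fun w => ?_
  rw [← groupForm_invMap, invMap_of, groupForm_of_setSum, groupForm_of_setSum]
  rfl

end GroupForm

/-! ### The descent algebra and its dual -/

section Descent

variable {W : Type u} [Group W] {S : Set W}

theorem descents_subset (w : W) : descents S w ⊆ S := fun _ h => h.1

variable [Finite W]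

/-- This turns membership in Σ(W) into a condition on coefficients, the form in which `mu` and `rho`
are shown to preserve it. -/
theorem mem_descentAlg_iff {x : MonoidAlgebra ℤ W} :
    x ∈ descentAlg S ↔ ∀ v w, descents S v = descents S w →
      groupForm W (MonoidAlgebra.of ℤ W v) x = groupForm W (MonoidAlgebra.of ℤ W w) x := by
  classical
  constructor
  · intro hx v w hvw
    induction hx using Submodule.span_induction with
    | mem y hy =>
      obtain ⟨I, -, rfl⟩ := hy
      rw [groupForm_of_setSum, groupForm_of_setSum]
      exact if_congr (by rw [descentClass, Set.mem_ofPred_eq, Set.mem_ofPred_eq, hvw]) rfl rfl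
    | zero => simp
    | add y z _ _ hy hz => rw [map_add, map_add, hy, hz]
    | smul a y _ hy => rw [map_smul, map_smul, hy]
  · intro hx
    have hfin := Fintype.ofFinite (Set W)
    -- Summing over all subsets of `W` is harmless: those that are not descent sets get coefficient
    -- 0.
    have hsum : x = ∑ I : Set W, (if hI : ∃ w, descents S w = I then
        groupForm W (MonoidAlgebra.of ℤ W hI.choose) x else 0) • setSum (descentClass S I) := by
      refine ext_groupForm fun w => ?_
      rw [map_sum, Finset.sum_eq_single (descents S w)]
      · have hw : ∃ v, descents S v = descents S w := ⟨w, rfl⟩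
        rw [dif_pos hw, map_smul, groupForm_of_setSum,
          if_pos (show w ∈ descentClass S (descents S w) from rfl), smul_eq_mul, mul_one,
          hx _ _ hw.choose_spec]
      · intro I _ hI
        rw [map_smul, groupForm_of_setSum,
          if_neg (fun h : w ∈ descentClass S I => hI h.symm), smul_zero]
      · simp
    rw [hsum]
    refine Submodule.sum_mem _ fun I _ => ?_
    by_cases hI : ∃ w, descents S w = I
    · refine Submodule.smul_mem _ _ (Submodule.subset_span ⟨I, ?_, rfl⟩)
      obtain ⟨w, rfl⟩ := hI
      exact descents_subset w
    · rw [dif_neg hI, zero_smul]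
      exact Submodule.zero_mem _

theorem chi_apply (u : MonoidAlgebra ℤ W) (x : descentAlg S) : chi S u x = groupForm W u x := rfl

theorem chiInv_apply (u : MonoidAlgebra ℤ W) (x : descentAlg S) :
    chiInv S u x = groupForm W (invMap W u) x := rfl

theorem coe_chiLam (x : descentAlg S) : (chiLam S x : DescentDual S) = chiInv S x := rfl

theorem span_descentElt :
    Submodule.span ℤ {x : descentAlg S | ∃ (I : Set W) (hI : I ⊆ S), x = descentElt S I hI} = ⊤ := by
  rw [eq_top_iff]
  rintro ⟨x, hx⟩ -
  induction hx using Submodule.span_induction with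
  | mem y hy =>
    obtain ⟨I, hI, rfl⟩ := hy
    exact Submodule.subset_span ⟨I, hI, rfl⟩
  | zero => exact Submodule.zero_mem _
  | add y z hy hz ihy ihz => exact Submodule.add_mem _ ihy ihz
  | smul a y hy ih => exact Submodule.smul_mem _ a ih

theorem linearMap_ext_descentElt {N : Type*} [AddCommGroup N] {g h : descentAlg S →ₗ[ℤ] N}
    (hgh : ∀ (I : Set W) (hI : I ⊆ S), g (descentElt S I hI) = h (descentElt S I hI)) : g = h :=
  LinearMap.ext_on span_descentElt (by rintro _ ⟨I, hI, rfl⟩; exact hgh I hI)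

/-- One representative of each nonempty descent class maps to the corresponding dual basis vector.
Empty classes contribute the zero vector to Σ(W) and impose nothing. -/
theorem chi_surjective : Function.Surjective (chi S) := by
  classical
  intro φ
  have hfin := Fintype.ofFinite (Set W)
  refine ⟨∑ I : Set W, if hI : ∃ w, descents S w = I then
      φ (descentElt S I (hI.choose_spec ▸ descents_subset _)) •
        MonoidAlgebra.of ℤ W hI.choose else 0, ?_⟩
  refine linearMap_ext_descentElt fun J hJ => ?_
  rw [map_sum, LinearMap.sum_apply, Finset.sum_eq_single J]
  · by_cases hI : ∃ w, descents S w = J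
    · rw [dif_pos hI, map_smul, LinearMap.smul_apply, chi_of_descentElt, if_pos hI.choose_spec,
        smul_eq_mul, mul_one]
    · have h0 : descentElt S J hJ = 0 := by
        refine Subtype.ext (ext_groupForm fun w => ?_)
        change groupForm W (MonoidAlgebra.of ℤ W w) (setSum (descentClass S J)) = _
        rw [groupForm_of_setSum, if_neg (fun h : w ∈ descentClass S J => hI ⟨w, h⟩),
          Submodule.coe_zero, map_zero]
      rw [dif_neg hI, h0, map_zero, map_zero]
  · intro I _ hIJ
    by_cases hI : ∃ w, descents S w = I
    · rw [dif_pos hI, map_smul, LinearMap.smul_apply, chi_of_descentElt,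
        if_neg (by rw [hI.choose_spec]; exact hIJ), smul_zero]
    · rw [dif_neg hI, map_zero, LinearMap.zero_apply]
  · simp

theorem chiInv_surjective : Function.Surjective (chiInv S) :=
  chi_surjective.comp invMap_surjective

theorem chiLam_surjective : Function.Surjective (chiLam S) := by
  rintro ⟨_, x, hx, rfl⟩
  exact ⟨⟨x, hx⟩, rfl⟩

/-! ### The form on `Λ` -/

theorem chiLam_apply_comm (x y : descentAlg S) :
    (chiLam S x : DescentDual S) y = (chiLam S y : DescentDual S) x := by
  rw [coe_chiLam, coe_chiLam, chiInv_apply, chiInv_apply, groupForm_invMap, groupForm_comm]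

/-- Well-definedness of `lamForm`: since `y` is itself some χ'(z), symmetry turns its value at `x`
into the value of χ'(x) at `z`. -/
theorem lam_apply_congr {x x' : descentAlg S} (h : chiLam S x = chiLam S x') (y : lam S) :
    (y : DescentDual S) x = (y : DescentDual S) x' := by
  obtain ⟨z, rfl⟩ := chiLam_surjective y
  rw [chiLam_apply_comm, h, chiLam_apply_comm]

/-- The form on `Λ(W)` for which `χ'` is adjoint to the inclusion of `Λ(W)` in `Σ*(W)`. -/
def lamForm (S : Set W) : LinearMap.BilinForm ℤ (lam S) :=
  LinearMap.mk₂ ℤ (fun a y => (y : DescentDual S) (Function.surjInv chiLam_surjective a))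
    (fun a b y => by
      rw [← map_add]
      refine lam_apply_congr ?_ y
      simp only [map_add, Function.surjInv_eq])
    (fun c a y => by
      rw [← map_smul]
      refine lam_apply_congr ?_ y
      simp only [map_smul, Function.surjInv_eq])
    (fun _ _ _ => rfl)
    (fun _ _ _ => rfl)

theorem lamForm_chiLam (x : descentAlg S) (y : lam S) :
    lamForm S (chiLam S x) y = (y : DescentDual S) x :=
  lam_apply_congr (Function.surjInv_eq chiLam_surjective _) y

theorem isLamForm_lamForm : IsLamForm S (lamForm S) := by
  classical
  intro I J hI hJ
  rw [lamElt, lamElt, lamForm_chiLam, coe_chiLam, chiInv_apply]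
  change groupForm W (invMap W (setSum (descentClass S J))) (setSum (descentClass S I)) = _
  -- With the inversion moved to the second argument, the sum runs over D(w) = J and tests D(w⁻¹) =
  -- I.
  rw [groupForm_invMap, invMap_setSum, setSum, map_sum, LinearMap.sum_apply]
  simp only [groupForm_of_setSum]
  rw [Finset.sum_boole, descentCount, Set.ncard_eq_toFinset_card _ (Set.toFinite _)]
  congr 2
  ext w
  rw [Finset.mem_filter, Set.Finite.mem_toFinset, Set.Finite.mem_toFinset]
  exact and_comm

theorem IsLamForm.eq_lamForm {B : LinearMap.BilinForm ℤ (lam S)} (hB : IsLamForm S B) :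
    B = lamForm S := by
  have h : B.compl₁₂ (chiLam S) (chiLam S) = (lamForm S).compl₁₂ (chiLam S) (chiLam S) := by
    refine linearMap_ext_descentElt fun I hI => linearMap_ext_descentElt fun J hJ => ?_
    exact (hB I J hI hJ).trans (isLamForm_lamForm I J hI hJ).symm
  refine LinearMap.ext fun a => LinearMap.ext fun b => ?_
  obtain ⟨x, rfl⟩ := chiLam_surjective a
  obtain ⟨y, rfl⟩ := chiLam_surjective b
  exact LinearMap.congr_fun (LinearMap.congr_fun h x) y

theorem lamForm_comm (a b : lam S) : lamForm S a b = lamForm S b a := by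
  obtain ⟨x, rfl⟩ := chiLam_surjective a
  obtain ⟨y, rfl⟩ := chiLam_surjective b
  rw [lamForm_chiLam, lamForm_chiLam, chiLam_apply_comm]

theorem lamForm_isSymm : (lamForm S).IsSymm := ⟨lamForm_comm⟩

/-- Pairing with χ'(x) is evaluation at `x`, so an element orthogonal to Λ vanishes as a functional.
Symmetry gives the other side. -/
theorem lamForm_nondegenerate : (lamForm S).Nondegenerate := by
  have h : ∀ b : lam S, (∀ a, lamForm S a b = 0) → b = 0 := fun b hb =>
    Subtype.ext (LinearMap.ext fun x => (lamForm_chiLam x b).symm.trans (hb _))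
  exact ⟨fun a ha => h a fun b => (lamForm_comm b a).trans (ha b), h⟩

end Descent

/-! ### Induced maps -/

section Induced

variable {A B M N : Type*} [AddCommGroup A] [AddCommGroup B] [AddCommGroup M] [AddCommGroup N]
  [Module ℤ A] [Module ℤ B] [Module ℤ M] [Module ℤ N]

theorem comp_restrictAlong {i : A →ₗ[ℤ] M} {j : B →ₗ[ℤ] N} {g : M →ₗ[ℤ] N}
    (h : ∃ g' : A →ₗ[ℤ] B, j ∘ₗ g' = g ∘ₗ i) : j ∘ₗ restrictAlong i j g = g ∘ₗ i := by
  rw [restrictAlong, dif_pos h]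
  exact h.choose_spec

theorem descendAlong_eq {p : M →ₗ[ℤ] A} {q : N →ₗ[ℤ] B} {g : M →ₗ[ℤ] N} {g' : A →ₗ[ℤ] B}
    (hp : Function.Surjective p) (h : g' ∘ₗ p = q ∘ₗ g) : descendAlong p q g = g' := by
  have hex : ∃ g' : A →ₗ[ℤ] B, g' ∘ₗ p = q ∘ₗ g := ⟨g', h⟩
  rw [descendAlong, dif_pos hex]
  exact LinearMap.ext fun a => by
    obtain ⟨m, rfl⟩ := hp a
    exact LinearMap.congr_fun (hex.choose_spec.trans h.symm) m

end Induced

/-! ### The maps of a parabolic embedding -/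

namespace IsParabolicEmbedding

variable {V W : Type u} [Group V] [Group W] {f : V →* W} {T : Set V} {S : Set W}

theorem invMap_mu [Finite W] (x : MonoidAlgebra ℤ V) :
    invMap W (mu f T S x) = muBar f T S (invMap V x) := by
  suffices hs : invMap W ∘ₗ mu f T S = muBar f T S ∘ₗ invMap V from LinearMap.congr_fun hs x
  refine linearMap_ext_of fun v => ?_
  rw [LinearMap.comp_apply, LinearMap.comp_apply, invMap_of, mu, muBar, linearExtend_of,
    linearExtend_of, setSum_mul_of, of_mul_setSum, invMap_setSum]
  congr 1
  ext w
  constructor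
  · rintro ⟨z, hz, hw⟩
    exact ⟨z⁻¹, by rwa [mem_rightReps, inv_inv], by rw [map_inv, ← mul_inv_rev, ← hw, inv_inv]⟩
  · rintro ⟨z, hz, rfl⟩
    exact ⟨z⁻¹, hz, by rw [mul_inv_rev, map_inv, inv_inv]⟩

variable (h : IsParabolicEmbedding f T S)
include h

theorem invMap_rho (u : MonoidAlgebra ℤ W) :
    invMap V (rho f T S u) = rhoBar f T S (invMap W u) := by
  suffices hs : invMap V ∘ₗ rho f T S = rhoBar f T S ∘ₗ invMap W from LinearMap.congr_fun hs u
  refine linearMap_ext_of fun w => ?_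
  rw [LinearMap.comp_apply, LinearMap.comp_apply, invMap_of, rho, rhoBar, linearExtend_of,
    linearExtend_of, invMap_of, h.leftFactor_eq_inv, inv_inv]

variable [Finite W]

/-- On group elements both sides test whether `w` lies in W^I · f(v), that is, whether `v` is the
right factor of `w`. -/
theorem groupForm_mu (u : MonoidAlgebra ℤ W) (x : MonoidAlgebra ℤ V) :
    groupForm W u (mu f T S x) = groupForm V (rhoBar f T S u) x := by
  classical
  suffices hs : (groupForm W).compl₂ (mu f T S) = groupForm V ∘ₗ rhoBar f T S from
    LinearMap.congr_fun (LinearMap.congr_fun hs u) x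
  refine linearMap_ext_of fun w => linearMap_ext_of fun v => ?_
  rw [LinearMap.compl₂_apply, LinearMap.comp_apply, mu, rhoBar, linearExtend_of, linearExtend_of,
    setSum_mul_of, groupForm_of_setSum, groupForm_of_of]
  refine if_congr ⟨?_, ?_⟩ rfl rfl
  · rintro ⟨z, hz, rfl⟩
    exact h.rightFactor_eq hz v
  · rintro rfl
    exact h.exists_mul_rightFactor w

theorem groupForm_muBar (x : MonoidAlgebra ℤ V) (u : MonoidAlgebra ℤ W) :
    groupForm W (muBar f T S x) u = groupForm V x (rho f T S u) := by
  nth_rw 1 [← invMap_invMap x]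
  rw [← invMap_mu, groupForm_invMap, groupForm_comm, h.groupForm_mu,
    ← h.invMap_rho, groupForm_comm, groupForm_invMap, invMap_invMap]

variable [Finite V]

/-- By adjointness the coefficient of `w` in `mu f T S x` is that of its right factor in `x`, and
the descents of this factor are determined by those of `w`. -/
theorem mu_mem {x : MonoidAlgebra ℤ V} (hx : x ∈ descentAlg T) :
    mu f T S x ∈ descentAlg S := by
  rw [mem_descentAlg_iff] at hx ⊢
  intro v w hvw
  rw [h.groupForm_mu, h.groupForm_mu, rhoBar, linearExtend_of, linearExtend_of]
  exact hx _ _ (by rw [h.descents_rightFactor, h.descents_rightFactor, hvw])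

/-- By adjointness the coefficient of `v` is the sum over `y` in ^I W of the coefficients of `f v *
y` in `u`. For equal descent sets these sums agree term by term. -/
theorem rho_mem {u : MonoidAlgebra ℤ W} (hu : u ∈ descentAlg S) :
    rho f T S u ∈ descentAlg T := by
  rw [mem_descentAlg_iff] at hu ⊢
  intro v w hvw
  rw [← h.groupForm_muBar, ← h.groupForm_muBar, muBar, linearExtend_of, linearExtend_of, setSum,
    Finset.mul_sum, Finset.mul_sum, map_sum, map_sum, LinearMap.sum_apply, LinearMap.sum_apply]
  refine Finset.sum_congr rfl fun y hy => ?_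
  rw [← map_mul, ← map_mul]
  exact hu _ _ (h.descents_mul_congr ((Set.Finite.mem_toFinset _).1 hy) hvw)

/-! ### Restrictions to Σ and Λ, and the induced maps on Σ* -/

theorem subtype_comp_muSigma :
    (descentAlg S).subtype ∘ₗ muSigma f T S = mu f T S ∘ₗ (descentAlg T).subtype :=
  comp_restrictAlong ⟨(mu f T S).restrict fun _ => h.mu_mem, rfl⟩

theorem subtype_comp_rhoSigma :
    (descentAlg T).subtype ∘ₗ rhoSigma f T S = rho f T S ∘ₗ (descentAlg S).subtype :=
  comp_restrictAlong ⟨(rho f T S).restrict fun _ => h.rho_mem, rfl⟩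

theorem coe_muSigma (x : descentAlg T) :
    (muSigma f T S x : MonoidAlgebra ℤ W) = mu f T S x :=
  LinearMap.congr_fun h.subtype_comp_muSigma x

theorem coe_rhoSigma (x : descentAlg S) :
    (rhoSigma f T S x : MonoidAlgebra ℤ V) = rho f T S x :=
  LinearMap.congr_fun h.subtype_comp_rhoSigma x

theorem dualMap_muSigma_comp_chi :
    (muSigma f T S).dualMap ∘ₗ chi S = chi T ∘ₗ rhoBar f T S := by
  refine LinearMap.ext fun u => LinearMap.ext fun x => ?_
  rw [LinearMap.comp_apply, LinearMap.dualMap_apply, chi_apply, h.coe_muSigma, h.groupForm_mu]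
  rfl

theorem dualMap_rhoSigma_comp_chi :
    (rhoSigma f T S).dualMap ∘ₗ chi T = chi S ∘ₗ muBar f T S := by
  refine LinearMap.ext fun u => LinearMap.ext fun x => ?_
  rw [LinearMap.comp_apply, LinearMap.dualMap_apply, chi_apply, h.coe_rhoSigma,
    ← h.groupForm_muBar]
  rfl

theorem rhoBarDual_eq : rhoBarDual f T S = (muSigma f T S).dualMap :=
  descendAlong_eq chi_surjective h.dualMap_muSigma_comp_chi

theorem muBarDual_eq : muBarDual f T S = (rhoSigma f T S).dualMap :=
  descendAlong_eq chi_surjective h.dualMap_rhoSigma_comp_chi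

theorem rhoBarDual_comp_chi : rhoBarDual f T S ∘ₗ chi S = chi T ∘ₗ rhoBar f T S := by
  rw [h.rhoBarDual_eq, h.dualMap_muSigma_comp_chi]

theorem muBarDual_comp_chi : muBarDual f T S ∘ₗ chi T = chi S ∘ₗ muBar f T S := by
  rw [h.muBarDual_eq, h.dualMap_rhoSigma_comp_chi]

theorem muBarDual_chiInv (x : MonoidAlgebra ℤ V) :
    muBarDual f T S (chiInv T x) = chiInv S (mu f T S x) := by
  change (muBarDual f T S ∘ₗ chi T) (invMap V x) = chi S (invMap W (mu f T S x))
  rw [h.muBarDual_comp_chi, invMap_mu]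
  rfl

theorem rhoBarDual_chiInv (u : MonoidAlgebra ℤ W) :
    rhoBarDual f T S (chiInv S u) = chiInv T (rho f T S u) := by
  change (rhoBarDual f T S ∘ₗ chi S) (invMap W u) = chi T (invMap V (rho f T S u))
  rw [h.rhoBarDual_comp_chi, h.invMap_rho]
  rfl

theorem subtype_comp_muBarLam :
    (lam S).subtype ∘ₗ muBarLam f T S = muBarDual f T S ∘ₗ (lam T).subtype := by
  refine comp_restrictAlong ⟨(muBarDual f T S).restrict ?_, rfl⟩
  rintro _ ⟨x, hx, rfl⟩
  rw [h.muBarDual_chiInv]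
  exact Submodule.mem_map_of_mem (h.mu_mem hx)

theorem subtype_comp_rhoBarLam :
    (lam T).subtype ∘ₗ rhoBarLam f T S = rhoBarDual f T S ∘ₗ (lam S).subtype := by
  refine comp_restrictAlong ⟨(rhoBarDual f T S).restrict ?_, rfl⟩
  rintro _ ⟨x, hx, rfl⟩
  rw [h.rhoBarDual_chiInv]
  exact Submodule.mem_map_of_mem (h.rho_mem hx)

theorem coe_muBarLam (y : lam T) :
    (muBarLam f T S y : DescentDual S) = muBarDual f T S y :=
  LinearMap.congr_fun h.subtype_comp_muBarLam y

theorem coe_rhoBarLam (y : lam S) :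
    (rhoBarLam f T S y : DescentDual T) = rhoBarDual f T S y :=
  LinearMap.congr_fun h.subtype_comp_rhoBarLam y

theorem chiLam_comp_muSigma :
    chiLam S ∘ₗ muSigma f T S = muBarLam f T S ∘ₗ chiLam T := by
  refine LinearMap.ext fun x => Subtype.ext ?_
  rw [LinearMap.comp_apply, LinearMap.comp_apply, h.coe_muBarLam, coe_chiLam, coe_chiLam,
    h.coe_muSigma, h.muBarDual_chiInv]

theorem chiLam_comp_rhoSigma :
    chiLam T ∘ₗ rhoSigma f T S = rhoBarLam f T S ∘ₗ chiLam S := by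
  refine LinearMap.ext fun x => Subtype.ext ?_
  rw [LinearMap.comp_apply, LinearMap.comp_apply, h.coe_rhoBarLam, coe_chiLam, coe_chiLam,
    h.coe_rhoSigma, h.rhoBarDual_chiInv]

/-- For `a` = χ'(x) both sides are the value of `b` at μ(x). -/
theorem lamForm_muBarLam (a : lam T) (b : lam S) :
    lamForm S (muBarLam f T S a) b = lamForm T a (rhoBarLam f T S b) := by
  obtain ⟨x, rfl⟩ := chiLam_surjective a
  have hx : muBarLam f T S (chiLam T x) = chiLam S (muSigma f T S x) :=
    (LinearMap.congr_fun h.chiLam_comp_muSigma x).symm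
  rw [hx, lamForm_chiLam, lamForm_chiLam, h.coe_rhoBarLam, h.rhoBarDual_eq, LinearMap.dualMap_apply]

end IsParabolicEmbedding

/-! ### Functoriality -/

section Functoriality

namespace IsCoxeterSystem

variable {W : Type u} [Group W] {S : Set W} (hS : IsCoxeterSystem S)
include hS

theorem rho_id : rho (MonoidHom.id W) S S = LinearMap.id := by
  refine linearMap_ext_of fun w => ?_
  rw [rho, linearExtend_of, hS.isParabolicEmbedding_id.leftFactor_eq_inv, hS.rightFactor_id,
    inv_inv, LinearMap.id_apply]

variable [Finite W]

theorem mu_id : mu (MonoidHom.id W) S S = LinearMap.id := by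
  refine LinearMap.ext fun x => ext_groupForm fun w => ?_
  rw [hS.isParabolicEmbedding_id.groupForm_mu, rhoBar, linearExtend_of, hS.rightFactor_id,
    LinearMap.id_apply]

theorem muSigma_id : muSigma (MonoidHom.id W) S S = LinearMap.id :=
  LinearMap.ext fun x => Subtype.ext <| by
    rw [hS.isParabolicEmbedding_id.coe_muSigma, hS.mu_id, LinearMap.id_apply, LinearMap.id_apply]

theorem rhoSigma_id : rhoSigma (MonoidHom.id W) S S = LinearMap.id :=
  LinearMap.ext fun x => Subtype.ext <| by
    rw [hS.isParabolicEmbedding_id.coe_rhoSigma, hS.rho_id, LinearMap.id_apply, LinearMap.id_apply]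

theorem muBarDual_id : muBarDual (MonoidHom.id W) S S = LinearMap.id := by
  rw [hS.isParabolicEmbedding_id.muBarDual_eq, hS.rhoSigma_id]
  rfl

theorem rhoBarDual_id : rhoBarDual (MonoidHom.id W) S S = LinearMap.id := by
  rw [hS.isParabolicEmbedding_id.rhoBarDual_eq, hS.muSigma_id]
  rfl

theorem muBarLam_id : muBarLam (MonoidHom.id W) S S = LinearMap.id :=
  LinearMap.ext fun x => Subtype.ext <| by
    rw [hS.isParabolicEmbedding_id.coe_muBarLam, hS.muBarDual_id, LinearMap.id_apply,
      LinearMap.id_apply]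

theorem rhoBarLam_id : rhoBarLam (MonoidHom.id W) S S = LinearMap.id :=
  LinearMap.ext fun x => Subtype.ext <| by
    rw [hS.isParabolicEmbedding_id.coe_rhoBarLam, hS.rhoBarDual_id, LinearMap.id_apply,
      LinearMap.id_apply]

end IsCoxeterSystem

namespace IsParabolicEmbedding

variable {U V W : Type u} [Group U] [Group V] [Group W]
  {g : U →* V} {f : V →* W} {R : Set U} {T : Set V} {S : Set W}
  (h : IsParabolicEmbedding f T S) (hg : IsParabolicEmbedding g R T)
include h hg

theorem rho_comp : rho (f.comp g) R S = rho g R T ∘ₗ rho f T S := by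
  refine linearMap_ext_of fun w => ?_
  simp only [rho, LinearMap.comp_apply, linearExtend_of]
  rw [(h.comp hg).leftFactor_eq_inv, h.leftFactor_eq_inv, hg.leftFactor_eq_inv, inv_inv,
    h.rightFactor_comp hg]

variable [Finite W] [Finite V]

/-- Adjointness replaces a factorization of sets of coset representatives by transitivity of right
factors. -/
theorem mu_comp : mu (f.comp g) R S = mu f T S ∘ₗ mu g R T := by
  refine LinearMap.ext fun x => ext_groupForm fun w => ?_
  rw [LinearMap.comp_apply, (h.comp hg).groupForm_mu, h.groupForm_mu, hg.groupForm_mu]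
  simp only [rhoBar, linearExtend_of]
  rw [h.rightFactor_comp hg]

variable [Finite U]

theorem muSigma_comp : muSigma (f.comp g) R S = muSigma f T S ∘ₗ muSigma g R T :=
  LinearMap.ext fun x => Subtype.ext <| by
    rw [(h.comp hg).coe_muSigma, LinearMap.comp_apply, h.coe_muSigma, hg.coe_muSigma,
      h.mu_comp hg, LinearMap.comp_apply]

theorem rhoSigma_comp : rhoSigma (f.comp g) R S = rhoSigma g R T ∘ₗ rhoSigma f T S :=
  LinearMap.ext fun x => Subtype.ext <| by
    rw [(h.comp hg).coe_rhoSigma, LinearMap.comp_apply, hg.coe_rhoSigma, h.coe_rhoSigma,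
      h.rho_comp hg, LinearMap.comp_apply]

theorem muBarDual_comp : muBarDual (f.comp g) R S = muBarDual f T S ∘ₗ muBarDual g R T := by
  rw [(h.comp hg).muBarDual_eq, h.muBarDual_eq, hg.muBarDual_eq, h.rhoSigma_comp hg]
  rfl

theorem rhoBarDual_comp : rhoBarDual (f.comp g) R S = rhoBarDual g R T ∘ₗ rhoBarDual f T S := by
  rw [(h.comp hg).rhoBarDual_eq, h.rhoBarDual_eq, hg.rhoBarDual_eq, h.muSigma_comp hg]
  rfl

theorem muBarLam_comp : muBarLam (f.comp g) R S = muBarLam f T S ∘ₗ muBarLam g R T :=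
  LinearMap.ext fun x => Subtype.ext <| by
    rw [(h.comp hg).coe_muBarLam, LinearMap.comp_apply, h.coe_muBarLam, hg.coe_muBarLam,
      h.muBarDual_comp hg, LinearMap.comp_apply]

theorem rhoBarLam_comp : rhoBarLam (f.comp g) R S = rhoBarLam g R T ∘ₗ rhoBarLam f T S :=
  LinearMap.ext fun x => Subtype.ext <| by
    rw [(h.comp hg).coe_rhoBarLam, LinearMap.comp_apply, hg.coe_rhoBarLam, h.coe_rhoBarLam,
      h.rhoBarDual_comp hg, LinearMap.comp_apply]

end IsParabolicEmbedding

/-! ### The eight functors, and monic and epic natural transformations -/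

theorem isFunctorial_Omega : IsFunctorial Omega.{u} :=
  ⟨fun X => congrArg ModuleCat.ofHom X.isCoxeterSystem.mu_id, fun f g => congrArg ModuleCat.ofHom
    ((Cox.Hom.isParabolicEmbedding g).mu_comp (Cox.Hom.isParabolicEmbedding f))⟩

theorem isFunctorial_Sigma : IsFunctorial Sigma.{u} :=
  ⟨fun X => congrArg ModuleCat.ofHom X.isCoxeterSystem.muSigma_id, fun f g =>
    congrArg ModuleCat.ofHom ((Cox.Hom.isParabolicEmbedding g).muSigma_comp (Cox.Hom.isParabolicEmbedding f))⟩

theorem isFunctorial_SigmaDual : IsFunctorial SigmaDual.{u} :=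
  ⟨fun X => congrArg ModuleCat.ofHom X.isCoxeterSystem.muBarDual_id, fun f g =>
    congrArg ModuleCat.ofHom ((Cox.Hom.isParabolicEmbedding g).muBarDual_comp (Cox.Hom.isParabolicEmbedding f))⟩

theorem isFunctorial_Lambda : IsFunctorial Lambda.{u} :=
  ⟨fun X => congrArg ModuleCat.ofHom X.isCoxeterSystem.muBarLam_id, fun f g =>
    congrArg ModuleCat.ofHom ((Cox.Hom.isParabolicEmbedding g).muBarLam_comp (Cox.Hom.isParabolicEmbedding f))⟩

theorem isFunctorial_OmegaOp : IsFunctorial OmegaOp.{u} :=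
  ⟨fun X => congrArg ModuleCat.ofHom X.unop.isCoxeterSystem.rho_id, fun f g =>
    congrArg ModuleCat.ofHom
      ((Cox.Hom.isParabolicEmbedding f.unop).rho_comp (Cox.Hom.isParabolicEmbedding g.unop))⟩

theorem isFunctorial_SigmaOp : IsFunctorial SigmaOp.{u} :=
  ⟨fun X => congrArg ModuleCat.ofHom X.unop.isCoxeterSystem.rhoSigma_id, fun f g =>
    congrArg ModuleCat.ofHom
      ((Cox.Hom.isParabolicEmbedding f.unop).rhoSigma_comp (Cox.Hom.isParabolicEmbedding g.unop))⟩

theorem isFunctorial_SigmaDualOp : IsFunctorial SigmaDualOp.{u} :=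
  ⟨fun X => congrArg ModuleCat.ofHom X.unop.isCoxeterSystem.rhoBarDual_id, fun f g =>
    congrArg ModuleCat.ofHom
      ((Cox.Hom.isParabolicEmbedding f.unop).rhoBarDual_comp (Cox.Hom.isParabolicEmbedding g.unop))⟩

theorem isFunctorial_LambdaOp : IsFunctorial LambdaOp.{u} :=
  ⟨fun X => congrArg ModuleCat.ofHom X.unop.isCoxeterSystem.rhoBarLam_id, fun f g =>
    congrArg ModuleCat.ofHom
      ((Cox.Hom.isParabolicEmbedding f.unop).rhoBarLam_comp (Cox.Hom.isParabolicEmbedding g.unop))⟩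

theorem mono_of_app_injective {C : Type*} [Category C] {F G : C ⥤ ModuleCat.{u} ℤ} (α : F ⟶ G)
    (h : ∀ X, Function.Injective (α.app X)) : Mono α :=
  have := fun X => (ModuleCat.mono_iff_injective (α.app X)).2 (h X)
  NatTrans.mono_of_mono_app α

theorem epi_of_app_surjective {C : Type*} [Category C] {F G : C ⥤ ModuleCat.{u} ℤ} (α : F ⟶ G)
    (h : ∀ X, Function.Surjective (α.app X)) : Epi α :=
  have := fun X => (ModuleCat.epi_iff_surjective (α.app X)).2 (h X)
  NatTrans.epi_of_epi_app α

end Functoriality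

end CoxDescent

end

theorem mainTheorem6 :
    -- The form on `Λ(W)`.
    (∀ {W : Type u} [Group W] [Finite W] (S : Set W), CoxDescent.IsCoxeterSystem S →
      (∃! B : LinearMap.BilinForm ℤ (CoxDescent.lam S), CoxDescent.IsLamForm S B) ∧
      ∀ B : LinearMap.BilinForm ℤ (CoxDescent.lam S), CoxDescent.IsLamForm S B →
        B.IsSymm ∧ B.Nondegenerate) ∧
    -- The diagram and its self-duality for a parabolic subgroup `W_I`, with inclusion `f`.
    (∀ {W : Type u} [Group W] [Finite W] (S : Set W), CoxDescent.IsCoxeterSystem S →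
      ∀ I : Set W, I ⊆ S →
      ∀ (f : Subgroup.closure I →* W) (T : Set (Subgroup.closure I)),
        f = (Subgroup.closure I).subtype → T = CoxDescent.parabolicGens I →
      -- The maps on `Σ` and `Λ` are restrictions, and the maps on `Σ*` are induced along `χ`.
      ((CoxDescent.descentAlg S).subtype ∘ₗ CoxDescent.muSigma f T S =
          CoxDescent.mu f T S ∘ₗ (CoxDescent.descentAlg T).subtype ∧
        (CoxDescent.descentAlg T).subtype ∘ₗ CoxDescent.rhoSigma f T S =
          CoxDescent.rho f T S ∘ₗ (CoxDescent.descentAlg S).subtype ∧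
        CoxDescent.muBarDual f T S ∘ₗ CoxDescent.chi T =
          CoxDescent.chi S ∘ₗ CoxDescent.muBar f T S ∧
        CoxDescent.rhoBarDual f T S ∘ₗ CoxDescent.chi S =
          CoxDescent.chi T ∘ₗ CoxDescent.rhoBar f T S) ∧
      -- The horizontal arrows are surjections and injections.
      (Function.Surjective (CoxDescent.chiLam S) ∧ Function.Surjective (CoxDescent.chiLam T) ∧
        Function.Injective (CoxDescent.lam S).subtype ∧
        Function.Injective (CoxDescent.lam T).subtype) ∧
      -- The four squares commute.
      (CoxDescent.chiLam S ∘ₗ CoxDescent.muSigma f T S =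
          CoxDescent.muBarLam f T S ∘ₗ CoxDescent.chiLam T ∧
        (CoxDescent.lam S).subtype ∘ₗ CoxDescent.muBarLam f T S =
          CoxDescent.muBarDual f T S ∘ₗ (CoxDescent.lam T).subtype ∧
        CoxDescent.chiLam T ∘ₗ CoxDescent.rhoSigma f T S =
          CoxDescent.rhoBarLam f T S ∘ₗ CoxDescent.chiLam S ∧
        (CoxDescent.lam T).subtype ∘ₗ CoxDescent.rhoBarLam f T S =
          CoxDescent.rhoBarDual f T S ∘ₗ (CoxDescent.lam S).subtype) ∧
      -- Rotation by a half turn gives the dual diagram.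
      ((∀ x φ, CoxDescent.rhoBarDual f T S φ x = φ (CoxDescent.muSigma f T S x)) ∧
        (∀ x φ, CoxDescent.muBarDual f T S φ x = φ (CoxDescent.rhoSigma f T S x)) ∧
        ∃ (C : LinearMap.BilinForm ℤ (CoxDescent.lam T))
          (B : LinearMap.BilinForm ℤ (CoxDescent.lam S)),
          CoxDescent.IsLamForm T C ∧ CoxDescent.IsLamForm S B ∧
          (∀ x y, B (CoxDescent.chiLam S x) y = (CoxDescent.lam S).subtype y x) ∧
          (∀ x y, C (CoxDescent.chiLam T x) y = (CoxDescent.lam T).subtype y x) ∧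
          (∀ x y, B (CoxDescent.muBarLam f T S x) y = C x (CoxDescent.rhoBarLam f T S y)))) ∧
    -- `Σ`, `Ω`, `Σ*` and `Λ` are representations of both categories, in commutative diamonds.
    (∃ (hΩ : CoxDescent.IsFunctorial CoxDescent.Omega.{u})
      (hS : CoxDescent.IsFunctorial CoxDescent.Sigma.{u})
      (hD : CoxDescent.IsFunctorial CoxDescent.SigmaDual.{u})
      (hL : CoxDescent.IsFunctorial CoxDescent.Lambda.{u})
      (ι : CoxDescent.toFunctor _ hS ⟶ CoxDescent.toFunctor _ hΩ)
      (χ : CoxDescent.toFunctor _ hΩ ⟶ CoxDescent.toFunctor _ hD)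
      (χL : CoxDescent.toFunctor _ hS ⟶ CoxDescent.toFunctor _ hL)
      (ιL : CoxDescent.toFunctor _ hL ⟶ CoxDescent.toFunctor _ hD),
      (∀ X, ι.app X = ModuleCat.ofHom (CoxDescent.descentAlg X.S).subtype) ∧
      (∀ X, χ.app X = ModuleCat.ofHom (CoxDescent.chiInv X.S)) ∧
      (∀ X, χL.app X = ModuleCat.ofHom (CoxDescent.chiLam X.S)) ∧
      (∀ X, ιL.app X = ModuleCat.ofHom (CoxDescent.lam X.S).subtype) ∧
      Mono ι ∧ Epi χ ∧ Epi χL ∧ Mono ιL ∧ ι ≫ χ = χL ≫ ιL) ∧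
    (∃ (hΩ : CoxDescent.IsFunctorial CoxDescent.OmegaOp.{u})
      (hS : CoxDescent.IsFunctorial CoxDescent.SigmaOp.{u})
      (hD : CoxDescent.IsFunctorial CoxDescent.SigmaDualOp.{u})
      (hL : CoxDescent.IsFunctorial CoxDescent.LambdaOp.{u})
      (ι : CoxDescent.toFunctor _ hS ⟶ CoxDescent.toFunctor _ hΩ)
      (χ : CoxDescent.toFunctor _ hΩ ⟶ CoxDescent.toFunctor _ hD)
      (χL : CoxDescent.toFunctor _ hS ⟶ CoxDescent.toFunctor _ hL)
      (ιL : CoxDescent.toFunctor _ hL ⟶ CoxDescent.toFunctor _ hD),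
      (∀ X, ι.app X = ModuleCat.ofHom (CoxDescent.descentAlg X.unop.S).subtype) ∧
      (∀ X, χ.app X = ModuleCat.ofHom (CoxDescent.chiInv X.unop.S)) ∧
      (∀ X, χL.app X = ModuleCat.ofHom (CoxDescent.chiLam X.unop.S)) ∧
      (∀ X, ιL.app X = ModuleCat.ofHom (CoxDescent.lam X.unop.S).subtype) ∧
      Mono ι ∧ Epi χ ∧ Epi χL ∧ Mono ιL ∧ ι ≫ χ = χL ≫ ιL) ∧
    -- Duality of these representations: `Σ*` is dual to `Σ`, and `Λ` is self-dual.
    (∀ (X Y : CoxDescent.Cox.{u}) (e : X ⟶ Y),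
      CoxDescent.rhoBarDual e.hom X.S Y.S = (CoxDescent.muSigma e.hom X.S Y.S).dualMap ∧
      CoxDescent.muBarDual e.hom X.S Y.S = (CoxDescent.rhoSigma e.hom X.S Y.S).dualMap ∧
      ∀ (C : LinearMap.BilinForm ℤ (CoxDescent.lam X.S))
        (B : LinearMap.BilinForm ℤ (CoxDescent.lam Y.S)),
        CoxDescent.IsLamForm X.S C → CoxDescent.IsLamForm Y.S B →
        ∀ x y, B (CoxDescent.muBarLam e.hom X.S Y.S x) y =
          C x (CoxDescent.rhoBarLam e.hom X.S Y.S y)) := by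
  refine ⟨?_, ?_, ?_, ?_, ?_⟩
  · intro W _ _ S _
    refine ⟨⟨CoxDescent.lamForm S, CoxDescent.isLamForm_lamForm, fun B hB => hB.eq_lamForm⟩, ?_⟩
    rintro B hB
    rw [hB.eq_lamForm]
    exact ⟨CoxDescent.lamForm_isSymm, CoxDescent.lamForm_nondegenerate⟩
  · rintro W _ _ S hS I hI f T rfl rfl
    have h := CoxDescent.isParabolicEmbedding_subtype hS hI
    refine ⟨⟨h.subtype_comp_muSigma, h.subtype_comp_rhoSigma, h.muBarDual_comp_chi,
      h.rhoBarDual_comp_chi⟩, ⟨CoxDescent.chiLam_surjective, CoxDescent.chiLam_surjective,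
      Subtype.val_injective, Subtype.val_injective⟩, ⟨h.chiLam_comp_muSigma,
      h.subtype_comp_muBarLam, h.chiLam_comp_rhoSigma, h.subtype_comp_rhoBarLam⟩, ?_, ?_,
      CoxDescent.lamForm _, CoxDescent.lamForm S, CoxDescent.isLamForm_lamForm,
      CoxDescent.isLamForm_lamForm, CoxDescent.lamForm_chiLam, CoxDescent.lamForm_chiLam,
      h.lamForm_muBarLam⟩
    · intro x φ
      rw [h.rhoBarDual_eq, LinearMap.dualMap_apply]
    · intro x φ
      rw [h.muBarDual_eq, LinearMap.dualMap_apply]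
  · refine ⟨CoxDescent.isFunctorial_Omega, CoxDescent.isFunctorial_Sigma,
      CoxDescent.isFunctorial_SigmaDual, CoxDescent.isFunctorial_Lambda,
      { app := fun X => ModuleCat.ofHom (CoxDescent.descentAlg X.S).subtype
        naturality := fun X Y e => congrArg ModuleCat.ofHom
          (CoxDescent.Cox.Hom.isParabolicEmbedding e).subtype_comp_muSigma },
      { app := fun X => ModuleCat.ofHom (CoxDescent.chiInv X.S)
        naturality := fun X Y e => congrArg ModuleCat.ofHom
          (LinearMap.ext fun x => ((CoxDescent.Cox.Hom.isParabolicEmbedding e).muBarDual_chiInv x).symm) },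
      { app := fun X => ModuleCat.ofHom (CoxDescent.chiLam X.S)
        naturality := fun X Y e => congrArg ModuleCat.ofHom
          (CoxDescent.Cox.Hom.isParabolicEmbedding e).chiLam_comp_muSigma },
      { app := fun X => ModuleCat.ofHom (CoxDescent.lam X.S).subtype
        naturality := fun X Y e => congrArg ModuleCat.ofHom
          (CoxDescent.Cox.Hom.isParabolicEmbedding e).subtype_comp_muBarLam },
      fun _ => rfl, fun _ => rfl, fun _ => rfl, fun _ => rfl,
      CoxDescent.mono_of_app_injective _ fun _ => Subtype.val_injective,
      CoxDescent.epi_of_app_surjective _ fun _ => CoxDescent.chiInv_surjective,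
      CoxDescent.epi_of_app_surjective _ fun _ => CoxDescent.chiLam_surjective,
      CoxDescent.mono_of_app_injective _ fun _ => Subtype.val_injective, rfl⟩
  · refine ⟨CoxDescent.isFunctorial_OmegaOp, CoxDescent.isFunctorial_SigmaOp,
      CoxDescent.isFunctorial_SigmaDualOp, CoxDescent.isFunctorial_LambdaOp,
      { app := fun X => ModuleCat.ofHom (CoxDescent.descentAlg X.unop.S).subtype
        naturality := fun X Y e => congrArg ModuleCat.ofHom
          (CoxDescent.Cox.Hom.isParabolicEmbedding e.unop).subtype_comp_rhoSigma },
      { app := fun X => ModuleCat.ofHom (CoxDescent.chiInv X.unop.S)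
        naturality := fun X Y e => congrArg ModuleCat.ofHom
          (LinearMap.ext fun x => ((CoxDescent.Cox.Hom.isParabolicEmbedding e.unop).rhoBarDual_chiInv x).symm) },
      { app := fun X => ModuleCat.ofHom (CoxDescent.chiLam X.unop.S)
        naturality := fun X Y e => congrArg ModuleCat.ofHom
          (CoxDescent.Cox.Hom.isParabolicEmbedding e.unop).chiLam_comp_rhoSigma },
      { app := fun X => ModuleCat.ofHom (CoxDescent.lam X.unop.S).subtype
        naturality := fun X Y e => congrArg ModuleCat.ofHom
          (CoxDescent.Cox.Hom.isParabolicEmbedding e.unop).subtype_comp_rhoBarLam },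
      fun _ => rfl, fun _ => rfl, fun _ => rfl, fun _ => rfl,
      CoxDescent.mono_of_app_injective _ fun _ => Subtype.val_injective,
      CoxDescent.epi_of_app_surjective _ fun _ => CoxDescent.chiInv_surjective,
      CoxDescent.epi_of_app_surjective _ fun _ => CoxDescent.chiLam_surjective,
      CoxDescent.mono_of_app_injective _ fun _ => Subtype.val_injective, rfl⟩
  · intro X Y e
    have h := CoxDescent.Cox.Hom.isParabolicEmbedding e
    refine ⟨h.rhoBarDual_eq, h.muBarDual_eq, ?_⟩
    intro C B hC hB
    rw [hC.eq_lamForm, hB.eq_lamForm]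
    exact h.lamForm_muBarLam
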